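/- **Separation Theorem.** Structures are finite, with non-empty universe; vocabularies are finite and consist of unary and binary relation symbols. For a structure $\mathfrak{M}$, the Gaifman graph $\mathrm{Gaif}(\mathfrak{M})$ is the simple undirected graph on the universe of $\mathfrak{M}$ in which two distinct elements $a,b$ are adjacent iff $(a,b)$ or $(b,a)$ belongs to some binary relation of $\mathfrak{M}$. A graph is *$k$-bounded* if its edges can be oriented so that every vertex has out-degree less than $k$. $\mathrm{MSO}(\mathcal{C})$ is the set of sentences of monadic second order logic over the vocabulary $\mathcal{C}$, with quantification over elements, over sets of elements, and over subsets of the relations of $\mathcal{C}$. $C^2(\mathcal{C})$ is the set of sentences over $\mathcal{C}$ of the two-variable fragment of first order logic with counting quantifiers $\exists^{\le n},\exists^{\ge n},\exists^{=n}$. The reduct of $\mathfrak{M}$ to a smaller vocabulary $\mathcal{C}$ is written $\mathfrak{M}|_{\mathcal{C}}$, and $\mathrm{tw}$ denotes tree-width. Given a natural number $k$, vocabularies $\mathcal{C}_{\mathrm{bd}}$ and $\mathcal{C}_{\mathrm{unbd}}$, and sentences $\alpha\in \mathrm{MSO}(\mathcal{C}_{\mathrm{bd}})$ and $\beta\in C^2(\mathcal{C}_{\mathrm{unbd}})$,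 one can effectively compute vocabularies $\mathcal{C}'_{\mathrm{bd}}$ and $\mathcal{C}'_{\mathrm{unbd}}$ such that $\mathcal{C}'_{\mathrm{bd}}\cap\mathcal{C}'_{\mathrm{unbd}}$ contains only unary relation symbols, and sentences $\alpha'\in \mathrm{MSO}(\mathcal{C}'_{\mathrm{bd}})$ and $\beta'\in C^2(\mathcal{C}'_{\mathrm{unbd}})$, such that: 1. For every $k$-bounded graph $G$ the following are equivalent: (i) there is a $(\mathcal{C}_{\mathrm{bd}}\cup\mathcal{C}_{\mathrm{unbd}})$-structure $\mathfrak{M}$ with $\mathfrak{M}\models\alpha\wedge\beta$ and $\mathrm{Gaif}(\mathfrak{M}|_{\mathcal{C}_{\mathrm{bd}}})=G$; (ii) there is a $(\mathcal{C}'_{\mathrm{bd}}\cup\mathcal{C}'_{\mathrm{unbd}})$-structure $\mathfrak{N}$ with $\mathfrak{N}\models\alpha'\wedge\beta'$ and $\mathrm{Gaif}(\mathfrak{N}|_{\mathcal{C}'_{\mathrm{bd}}})=G$. 2. The following are equivalent: (i) there is a $(\mathcal{C}_{\mathrm{bd}}\cup\mathcal{C}_{\mathrm{unbd}})$-structure $\mathfrak{M}$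 with $\mathfrak{M}\models\alpha\wedge\beta$ and $\mathrm{tw}(\mathfrak{M}|_{\mathcal{C}_{\mathrm{bd}}})\le k$; (ii) there is a $(\mathcal{C}'_{\mathrm{bd}}\cup\mathcal{C}'_{\mathrm{unbd}})$-structure $\mathfrak{N}$ with $\mathfrak{N}\models\alpha'\wedge\beta'$ and $\mathrm{tw}(\mathfrak{N}|_{\mathcal{C}'_{\mathrm{bd}}})\le k$. -/

import Mathlib

universe u

/-! ## Vocabularies and finite structures over unary and binary relation symbols -/

/-- A finite vocabulary of unary and binary relation symbols.  The unary symbols are drawn from one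
countable supply, the binary symbols from another (disjoint) one; both supplies are indexed by `ℕ`.
The finite sets of symbols are presented by lists, of which only the membership relation is used. -/
structure Vocab where
  un : List ℕ
  bin : List ℕ

namespace Vocab

/-- The union of two vocabularies. -/
def union (C D : Vocab) : Vocab := ⟨C.un ++ D.un, C.bin ++ D.bin⟩

instance : Union Vocab := ⟨union⟩

/-- Inclusion of vocabularies. -/
instance : HasSubset Vocab := ⟨fun C D => (∀ P ∈ C.un, P ∈ D.un) ∧ (∀ B ∈ C.bin, B ∈ D.bin)⟩

theorem subset_union_left (C D : Vocab) : C ⊆ C ∪ D :=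
  ⟨fun _ h => List.mem_append_left _ h, fun _ h => List.mem_append_left _ h⟩

/-- The common symbols of the two vocabularies are all unary. -/
def ShareOnlyUnary (C D : Vocab) : Prop := ∀ B ∈ C.bin, B ∉ D.bin

def equivLists : Vocab ≃ List ℕ × List ℕ where
  toFun C := (C.un, C.bin)
  invFun p := ⟨p.1, p.2⟩
  left_inv _ := rfl
  right_inv _ := rfl

instance : Primcodable Vocab := Primcodable.ofEquiv _ equivLists

end Vocab

/-- A `C`-structure with universe `V`: an interpretation of exactly the symbols of `C`. -/
structure Str (C : Vocab) (V : Type u) where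
  un : {P // P ∈ C.un} → V → Prop
  bin : {B // B ∈ C.bin} → V → V → Prop

namespace Str

variable {C D : Vocab} {V : Type u}

/-- The reduct of a `D`-structure to a smaller vocabulary `C`. -/
def reduct (M : Str D V) (h : C ⊆ D) : Str C V where
  un P := M.un ⟨P.1, h.1 P.1 P.2⟩
  bin B := M.bin ⟨B.1, h.2 B.1 B.2⟩

/-- The Gaifman graph: distinct elements are adjacent iff some binary relation of the structure
holds between them, in one direction or the other. -/
def gaifman (M : Str C V) : SimpleGraph V :=
  SimpleGraph.fromRel fun a b => ∃ B, M.bin B a b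

end Str

/-! ## Formulas -/

/-- A common syntax for monadic second order logic and for first order logic with counting.
There are three sorts of variables, each indexed by `ℕ`: element variables (`x`, `y`), set
variables (`X`), and variables for subsets of binary relations (`Z`). -/
inductive Formula where
  /-- `x ≈ y` -/
  | eq (x y : ℕ)
  /-- `P(x)` for a unary relation symbol `P` -/
  | un (P x : ℕ)
  /-- `B(x, y)` for a binary relation symbol `B` -/
  | bin (B x y : ℕ)
  /-- `X(x)` for a set variable `X` -/
  | mem (X x : ℕ)
  /-- `Z(x, y)` for a variable `Z` ranging over subsets of a binary relation -/
  | mem₂ (Z x y : ℕ)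
  | neg (φ : Formula)
  | and (φ ψ : Formula)
  /-- `∃ x, φ` -/
  | ex (x : ℕ) (φ : Formula)
  /-- `∃^{≥ n} x, φ`; as usual, `∃^{≤ n}` is `¬ ∃^{≥ n + 1}`, and `∃^{= n}` is the conjunction of
  `∃^{≤ n}` and `∃^{≥ n}` -/
  | exGe (n x : ℕ) (φ : Formula)
  /-- `∃ X, φ`, with `X` ranging over the sets of elements -/
  | exSet (X : ℕ) (φ : Formula)
  /-- `∃ Z ⊆ B, φ`, with `Z` ranging over the subsets of the binary relation `B`
  (quantification over the subsets of a unary relation is already available through `exSet`) -/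
  | exSub (Z B : ℕ) (φ : Formula)

namespace Formula

/-- All relation symbols that occur in the formula belong to `C`. -/
def Over (C : Vocab) : Formula → Prop
  | eq _ _ => True
  | un P _ => P ∈ C.un
  | bin B _ _ => B ∈ C.bin
  | mem _ _ => True
  | mem₂ _ _ _ => True
  | neg φ => φ.Over C
  | and φ ψ => φ.Over C ∧ ψ.Over C
  | ex _ φ => φ.Over C
  | exGe _ _ φ => φ.Over C
  | exSet _ φ => φ.Over C
  | exSub _ B φ => B ∈ C.bin ∧ φ.Over C

/-- The formula belongs to monadic second order logic: no counting quantifier occurs in it. -/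
def IsMSO : Formula → Prop
  | eq _ _ => True
  | un _ _ => True
  | bin _ _ _ => True
  | mem _ _ => True
  | mem₂ _ _ _ => True
  | neg φ => φ.IsMSO
  | and φ ψ => φ.IsMSO ∧ ψ.IsMSO
  | ex _ φ => φ.IsMSO
  | exGe _ _ _ => False
  | exSet _ φ => φ.IsMSO
  | exSub _ _ φ => φ.IsMSO

/-- The formula belongs to the two-variable fragment of first order logic with counting: nothing
second order occurs in it, and its only element variables are the two variables `0` and `1`. -/
def IsC2 : Formula → Prop
  | eq x y => x < 2 ∧ y < 2
  | un _ x => x < 2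
  | bin _ x y => x < 2 ∧ y < 2
  | mem _ _ => False
  | mem₂ _ _ _ => False
  | neg φ => φ.IsC2
  | and φ ψ => φ.IsC2 ∧ ψ.IsC2
  | ex x φ => x < 2 ∧ φ.IsC2
  | exGe _ x φ => x < 2 ∧ φ.IsC2
  | exSet _ _ => False
  | exSub _ _ _ => False

/-- The free element variables. -/
def freeEl : Formula → Set ℕ
  | eq x y => {x, y}
  | un _ x => {x}
  | bin _ x y => {x, y}
  | mem _ x => {x}
  | mem₂ _ x y => {x, y}
  | neg φ => φ.freeEl
  | and φ ψ => φ.freeEl ∪ ψ.freeEl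
  | ex x φ => φ.freeEl \ {x}
  | exGe _ x φ => φ.freeEl \ {x}
  | exSet _ φ => φ.freeEl
  | exSub _ _ φ => φ.freeEl

/-- The free set variables. -/
def freeSet : Formula → Set ℕ
  | eq _ _ => ∅
  | un _ _ => ∅
  | bin _ _ _ => ∅
  | mem X _ => {X}
  | mem₂ _ _ _ => ∅
  | neg φ => φ.freeSet
  | and φ ψ => φ.freeSet ∪ ψ.freeSet
  | ex _ φ => φ.freeSet
  | exGe _ _ φ => φ.freeSet
  | exSet X φ => φ.freeSet \ {X}
  | exSub _ _ φ => φ.freeSet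

/-- The free variables for subsets of binary relations. -/
def freeRel : Formula → Set ℕ
  | eq _ _ => ∅
  | un _ _ => ∅
  | bin _ _ _ => ∅
  | mem _ _ => ∅
  | mem₂ Z _ _ => {Z}
  | neg φ => φ.freeRel
  | and φ ψ => φ.freeRel ∪ ψ.freeRel
  | ex _ φ => φ.freeRel
  | exGe _ _ φ => φ.freeRel
  | exSet _ φ => φ.freeRel
  | exSub Z _ φ => φ.freeRel \ {Z}

/-- A sentence is a formula without free variables. -/
def IsSentence (φ : Formula) : Prop := φ.freeEl = ∅ ∧ φ.freeSet = ∅ ∧ φ.freeRel = ∅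

/-! ### Gödel numbering -/

/-- The Gödel number of a formula. -/
def code : Formula → ℕ
  | eq x y => 11 * Nat.pair x y
  | un P x => 11 * Nat.pair P x + 1
  | bin B x y => 11 * Nat.pair B (Nat.pair x y) + 2
  | mem X x => 11 * Nat.pair X x + 3
  | mem₂ Z x y => 11 * Nat.pair Z (Nat.pair x y) + 4
  | neg φ => 11 * φ.code + 5
  | and φ ψ => 11 * Nat.pair φ.code ψ.code + 6
  | ex x φ => 11 * Nat.pair x φ.code + 7
  | exGe n x φ => 11 * Nat.pair n (Nat.pair x φ.code) + 8
  | exSet X φ => 11 * Nat.pair X φ.code + 9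
  | exSub Z B φ => 11 * Nat.pair Z (Nat.pair B φ.code) + 10

/-- The formula with a given Gödel number. -/
def ofCode (c : ℕ) : Formula :=
  let m := c / 11
  let a := m.unpair.1
  let b := m.unpair.2
  if h0 : c % 11 = 0 then eq a b
  else if c % 11 = 1 then un a b
  else if c % 11 = 2 then bin a b.unpair.1 b.unpair.2
  else if c % 11 = 3 then mem a b
  else if c % 11 = 4 then mem₂ a b.unpair.1 b.unpair.2
  else if h5 : c % 11 = 5 then
    have : m < c := by omega
    neg (ofCode m)
  else if h6 : c % 11 = 6 then
    have : a < c := lt_of_le_of_lt m.unpair_left_le (by omega)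
    have : b < c := lt_of_le_of_lt m.unpair_right_le (by omega)
    and (ofCode a) (ofCode b)
  else if h7 : c % 11 = 7 then
    have : b < c := lt_of_le_of_lt m.unpair_right_le (by omega)
    ex a (ofCode b)
  else if h8 : c % 11 = 8 then
    have : b.unpair.2 < c :=
      lt_of_le_of_lt (b.unpair_right_le.trans m.unpair_right_le) (by omega)
    exGe a b.unpair.1 (ofCode b.unpair.2)
  else if h9 : c % 11 = 9 then
    have : b < c := lt_of_le_of_lt m.unpair_right_le (by omega)
    exSet a (ofCode b)
  else
    have : b.unpair.2 < c :=
      lt_of_le_of_lt (b.unpair_right_le.trans m.unpair_right_le) (by omega)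
    exSub a b.unpair.1 (ofCode b.unpair.2)
termination_by c

theorem ofCode_code (φ : Formula) : ofCode φ.code = φ := by
  induction φ <;> rw [ofCode] <;>
    simp_all [code, Nat.mul_add_div]

theorem code_ofCode (c : ℕ) : (ofCode c).code = c := by
  induction c using Nat.strong_induction_on with
  | _ c ih =>
    have hl : (c / 11).unpair.1 ≤ c / 11 := Nat.unpair_left_le _
    have hr : (c / 11).unpair.2 ≤ c / 11 := Nat.unpair_right_le _
    have hrr : (c / 11).unpair.2.unpair.2 ≤ c / 11 := (Nat.unpair_right_le _).trans hr
    have hlt : c % 11 < 11 := Nat.mod_lt _ (by norm_num)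
    rw [ofCode]
    dsimp only
    split_ifs <;> simp only [code]
    all_goals first
      | (simp only [Nat.pair_unpair]; omega)
      | (rw [ih _ (by omega)]; omega)
      | (rw [ih _ (by omega)]; simp only [Nat.pair_unpair]; omega)
      | (rw [ih _ (by omega), ih _ (by omega)]; simp only [Nat.pair_unpair]; omega)

/-- The Gödel numbering is a bijection, so that computability of functions on formulas is
computability of the corresponding functions on Gödel numbers. -/
def equivNat : Formula ≃ ℕ where
  toFun := code
  invFun := ofCode
  left_inv := ofCode_code
  right_inv := code_ofCode

instance : Primcodable Formula := Primcodable.ofEquiv ℕ equivNat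

end Formula

/-- The sentences of monadic second order logic over the vocabulary `C`. -/
def MSO (C : Vocab) : Set Formula := {φ | φ.IsMSO ∧ φ.Over C ∧ φ.IsSentence}

/-- The sentences of the two-variable fragment with counting over the vocabulary `C`. -/
def C2 (C : Vocab) : Set Formula := {φ | φ.IsC2 ∧ φ.Over C ∧ φ.IsSentence}

/-! ## Semantics -/

namespace Str

variable {C : Vocab} {V : Type u}

/-- Satisfaction of a formula in a `C`-structure, under an assignment `e` of elements, `s` of sets
of elements and `r` of binary relations to the variables.  (Atoms with a symbol outside `C`, which
do not occur in formulas over `C`, count as false.) -/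
def Sat (M : Str C V) : (e : ℕ → V) → (s : ℕ → Set V) → (r : ℕ → V → V → Prop) → Formula → Prop
  | e, _, _, .eq x y => e x = e y
  | e, _, _, .un P x => ∃ h : P ∈ C.un, M.un ⟨P, h⟩ (e x)
  | e, _, _, .bin B x y => ∃ h : B ∈ C.bin, M.bin ⟨B, h⟩ (e x) (e y)
  | e, s, _, .mem X x => e x ∈ s X
  | e, _, r, .mem₂ Z x y => r Z (e x) (e y)
  | e, s, r, .neg φ => ¬ M.Sat e s r φ
  | e, s, r, .and φ ψ => M.Sat e s r φ ∧ M.Sat e s r ψ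
  | e, s, r, .ex x φ => ∃ a : V, M.Sat (Function.update e x a) s r φ
  | e, s, r, .exGe n x φ => (n : ℕ∞) ≤ {a : V | M.Sat (Function.update e x a) s r φ}.encard
  | e, s, r, .exSet X φ => ∃ S : Set V, M.Sat e (Function.update s X S) r φ
  | e, s, r, .exSub Z B φ => ∃ R : V → V → Prop,
      (∀ a b, R a b → ∃ h : B ∈ C.bin, M.bin ⟨B, h⟩ a b) ∧ M.Sat e s (Function.update r Z R) φ

/-- `M` is a model of the sentence `φ`.  (The assignment is irrelevant for sentences.) -/
def Models (M : Str C V) (φ : Formula) : Prop := ∀ e s r, M.Sat e s r φ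

end Str

/-! ## Graphs -/

namespace SimpleGraph

variable {V : Type u}

/-- `G` is `k`-bounded if its edges can be oriented such that every vertex has out-degree less
than `k`. -/
def IsKBounded (G : SimpleGraph V) (k : ℕ) : Prop :=
  ∃ o : V → V → Prop, (∀ a b, G.Adj a b ↔ o a b ∨ o b a) ∧ (∀ a b, o a b → ¬ o b a) ∧
    ∀ a, {b | o a b}.encard < k

/-- `G` has tree-width at most `k`: it has a tree decomposition all of whose bags have at most
`k + 1` elements. -/
def TreewidthLE (G : SimpleGraph V) (k : ℕ) : Prop :=
  ∃ (ι : Type) (_ : Finite ι) (T : SimpleGraph ι) (bag : ι → Set V),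
    T.IsTree ∧
    (∀ v, ∃ t, v ∈ bag t) ∧
    (∀ v w, G.Adj v w → ∃ t, v ∈ bag t ∧ w ∈ bag t) ∧
    (∀ v, (T.induce {t | v ∈ bag t}).Preconnected) ∧
    ∀ t, (bag t).encard ≤ k + 1

end SimpleGraph

/-! The sentence `β` may also speak about the bounded relations. So its side receives a copy of
them, and this copy must be kept in agreement with the originals by unary symbols alone. An
orientation of out-degree at most `K` splits the edges of the graph into boundedly many partial
functions, the links. Each side has its own version of the links. Shared unary symbols record at
each element which links are defined there, the type of the successor, and which relations hold
along the link. In a model of the separated sentences the two versions therefore agree up to types.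
For each element `x` a type-preserving permutation matches its successors in one version with those
in the other, and exchanging pairs of elements accordingly makes the versions coincide
(`exists_rewiring`, applied in `exists_rewired`).

The exchange must not affect the truth of `β`. For each quantified subformula `∃^{≥ n}` a new binary
relation records, at each element, `n` witnesses, or all of them if there are fewer, and a unary
symbol records the truth value. That value depends only on the number of recorded witnesses, which a
permutation preserves. Since a formula with two variables sees only one pair at a time, replacing
pairs by pairs of the same types then preserves truth (`holds_iff_holds_hat`).

A pair is permuted from both of its ends, and the two requests might conflict. Call links and
recorded witnesses messages. They have bounded out-degree, so boundedly many colours suffice to give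
distinct colours to the distinct ends of every message path of length two
(`exists_coloring_of_paths`). With the colour part of the type, and with the edges that are answered
by a message placed in symmetric links (`exists_links`), the requests are compatible.

Conversely, a model of the original sentences expands to one of the separated sentences
(`exists_spec`). Bounded tree-width is covered because it implies an orientation of bounded
out-degree (`SimpleGraph.TreewidthLE.isKBounded`). The construction is primitive recursive. -/

/-! ## Colourings of sparse digraphs -/

/-- In a finite digraph in which all out-degrees are at most `d`, every nonempty set contains a
vertex with at most `2 * d` neighbours in the set. -/
theorem exists_card_neighbors_le {V : Type u} [DecidableEq V] (R : V → V → Prop)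
    [DecidableRel R] (d : ℕ) (S : Finset V) (hS : S.Nonempty)
    (hR : ∀ a ∈ S, (S.filter (R a)).card ≤ d) :
    ∃ a ∈ S, (S.filter fun b => R a b ∨ R b a).card ≤ 2 * d := by
  -- In-degrees and out-degrees have the same sum, so the average number of neighbours is at most `2
  -- * d`.
  by_contra! hcon
  have h1 : ∑ a ∈ S, (S.filter (R a)).card = ∑ a ∈ S, (S.filter fun b => R b a).card :=
    Finset.sum_card_bipartiteAbove_eq_sum_card_bipartiteBelow R
  have h2 : ∑ a ∈ S, (S.filter (R a)).card ≤ S.card * d := by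
    simpa using Finset.sum_le_sum hR
  have h3 : ∑ _a ∈ S, (2 * d + 1) ≤ ∑ a ∈ S, (S.filter fun b => R a b ∨ R b a).card :=
    Finset.sum_le_sum fun a ha => hcon a ha
  have h4 : ∑ a ∈ S, (S.filter fun b => R a b ∨ R b a).card ≤
      ∑ a ∈ S, ((S.filter (R a)).card + (S.filter fun b => R b a).card) :=
    Finset.sum_le_sum fun a _ => by
      rw [Finset.filter_or]; exact Finset.card_union_le _ _
  rw [Finset.sum_add_distrib] at h4
  simp only [Finset.sum_const, smul_eq_mul] at h3
  have := hS.card_pos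
  nlinarith

/-- Greedy colouring of a degenerate graph: remove a vertex with at most `2 * d` neighbours, colour
the rest, and give that vertex a colour its neighbours do not use. -/
theorem exists_coloring_of_outdegree_le {V : Type u} [Finite V] (R : V → V → Prop) (d : ℕ)
    (hR : ∀ a, {b | R a b}.encard ≤ d) :
    ∃ c : V → ℕ, (∀ a, c a < 2 * d + 1) ∧ ∀ a b, a ≠ b → R a b → c a ≠ c b := by
  classical
  have := Fintype.ofFinite V
  have key : ∀ n, ∀ S : Finset V, S.card = n →
      ∃ c : V → ℕ, (∀ a, c a < 2 * d + 1) ∧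
        ∀ a ∈ S, ∀ b ∈ S, a ≠ b → R a b → c a ≠ c b := by
    intro n
    induction n with
    | zero =>
      intro S hS
      rw [Finset.card_eq_zero] at hS
      exact ⟨fun _ => 0, by simp, by simp [hS]⟩
    | succ n ih =>
      intro S hS
      obtain ⟨v, hv, hcard⟩ := exists_card_neighbors_le R d S (Finset.card_pos.1 (by omega))
        (fun a _ => by
          have h := hR a
          have h' : ((S.filter (R a) : Finset V) : Set V).encard ≤ d :=
            (Set.encard_le_encard (by intro x; simp)).trans h
          rwa [Set.encard_coe_eq_coe_finsetCard, Nat.cast_le] at h')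
      obtain ⟨c, hc, hc'⟩ := ih (S.erase v) (by rw [Finset.card_erase_of_mem hv]; omega)
      obtain ⟨q, hq, hq'⟩ : ∃ q ∈ Finset.range (2 * d + 1),
          q ∉ (S.filter fun b => R v b ∨ R b v).image c := by
        apply Finset.exists_mem_notMem_of_card_lt_card
        rw [Finset.card_range]
        exact lt_of_le_of_lt Finset.card_image_le (by omega)
      simp only [Finset.mem_image, Finset.mem_filter, not_exists, not_and] at hq'
      refine ⟨Function.update c v q, fun a => ?_, fun a ha b hb hab hR => ?_⟩
      · by_cases h : a = v
        · subst h; simpa using hq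
        · simpa [h] using hc a
      · by_cases h : a = v
        · subst h
          simpa [hab.symm] using fun h => hq' b ⟨hb, Or.inl hR⟩ h.symm
        · by_cases h' : b = v
          · subst h'
            simpa [h] using hq' a ⟨ha, Or.inr hR⟩
          · simpa [h, h'] using hc' a (by simp [h, ha]) b (by simp [h', hb]) hab hR
  obtain ⟨c, hc, hc'⟩ := key _ Finset.univ rfl
  exact ⟨c, hc, fun a b => hc' a (Finset.mem_univ _) b (Finset.mem_univ _)⟩

/-- A finite digraph of bounded out-degree has a colouring with boundedly many colours in which
the ends of each directed path of length two agree only if they coincide. -/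
theorem exists_coloring_of_paths {V : Type u} [Finite V] (R : V → V → Prop) (m : ℕ)
    (hR : ∀ a, {b | R a b}.encard ≤ m) :
    ∃ c : V → ℕ, (∀ a, c a < 2 * (m * m) + 1) ∧
      ∀ a b b', R b a → R a b' → c b = c b' → b = b' := by
  classical
  -- The relation to be coloured is `R` composed with itself, of out-degree at most `m * m`.
  obtain ⟨c, hc, hc'⟩ := exists_coloring_of_outdegree_le (fun b b' => ∃ a, R b a ∧ R a b') (m * m)
    (fun b => by
      have := Fintype.ofFinite V
      have hcard : ∀ a, (Finset.univ.filter (R a)).card ≤ m := fun a => by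
        have h := hR a
        rw [← Nat.cast_le (α := ℕ∞), ← Set.encard_coe_eq_coe_finsetCard]
        simpa using h
      have : {b' | ∃ a, R b a ∧ R a b'} =
          (((Finset.univ.filter (R b)).biUnion fun a => Finset.univ.filter (R a) : Finset V) :
            Set V) := by
        ext; simp
      rw [this, Set.encard_coe_eq_coe_finsetCard, Nat.cast_le]
      exact (Finset.card_biUnion_le_card_mul _ _ m fun a _ => hcard a).trans
        (Nat.mul_le_mul_right _ (hcard b)))
  exact ⟨c, hc, fun a b b' h1 h2 h3 => by_contra fun h => hc' b b' h ⟨a, h1, h2⟩ h3⟩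

/-! ## Decomposing the edges of a bounded graph into partial functions -/

/-- Let `o` be an orientation of out-degree at most `K`, and let `w` be a relation of bounded
out-degree.  The edges of `o` decompose into partial functions `h j`, where the edges that are
reciprocated by `o` or `w` are in the symmetric ones (`K ≤ j`), and there is a colouring that is
injective on the ends of the paths of length two. -/
theorem exists_links {V : Type u} [Finite V] (o w : V → V → Prop) (K m Q : ℕ)
    (ho : ∀ a b, o a b → ¬ o b a) (hoK : ∀ a, {b | o a b}.encard ≤ K)
    (hw : ∀ a, {b | w a b}.encard ≤ m) (hQ : Q = 2 * ((K + m) * (K + m)) + 1) :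
    ∃ (c : V → ℕ) (h : ℕ → V → V → Prop),
      (∀ a, c a < Q) ∧
      (∀ a b b', (w b a ∨ o b a) → (w a b' ∨ o a b') → c b = c b' → b = b') ∧
      (∀ j a b, h j a b → j < K + 2 * Q) ∧
      (∀ j a b b', h j a b → h j a b' → b = b') ∧
      (∀ j a, ¬ h j a a) ∧
      (∀ i j a b, h i a b → h j a b → i = j) ∧
      (∀ j a b, j < K → h j a b → ¬ (w b a ∨ o b a)) ∧
      (∀ j a b, K ≤ j → h j a b → h j b a) ∧
      (∀ a b, (∃ j, h j a b ∨ h j b a) ↔ o a b ∨ o b a) ∧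
      (∀ a b, (w a b ∨ ∃ j, h j a b) ↔ w a b ∨ o a b) := by
  classical
  obtain ⟨c, hc, hc'⟩ := exists_coloring_of_paths (fun a b => w a b ∨ o a b) (K + m) fun a => by
    have : {b | w a b ∨ o a b} = {b | o a b} ∪ {b | w a b} := by ext; simp [or_comm]
    rw [this, Nat.cast_add]
    exact (Set.encard_union_le _ _).trans (add_le_add (hoK a) (hw a))
  rw [← hQ] at hc
  have hidx : ∀ a, ∃ f : V → ℕ, (∀ b, o a b → f b < K) ∧
      ∀ b b', o a b → o a b' → f b = f b' → b = b' := fun a => by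
    have hcard : {b | o a b}.ncard ≤ K := by
      have := hoK a
      rwa [← (Set.toFinite {b | o a b}).cast_ncard_eq, Nat.cast_le] at this
    have e := Finite.equivFin {b | o a b}
    refine ⟨fun b => if hb : o a b then (e ⟨b, hb⟩ : ℕ) else 0, fun b hb => ?_,
      fun b b' hb hb' hbb => ?_⟩
    · simp only [hb, dite_true]
      exact (e ⟨b, hb⟩).2.trans_le hcard
    · simp only [hb, hb', dite_true] at hbb
      simpa using e.injective (Fin.ext hbb)
  choose f hfK hf using hidx
  have hirr : ∀ a, ¬ o a a := fun a h => ho a a h h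
  -- An unanswered edge gets its number among the edges leaving its source. An answered one gets `K`
  -- plus the sum of the colours of its ends: this is symmetric, stays below `K + 2 * Q`, and
  -- together with one end determines the colour of the other.
  refine ⟨c, fun j a b => (j < K ∧ o a b ∧ ¬ w b a ∧ f a b = j) ∨
    (K ≤ j ∧ (o a b ∧ w b a ∨ o b a ∧ w a b) ∧ c a + c b + K = j), hc, hc', ?_, ?_, ?_, ?_, ?_, ?_,
    ?_, ?_⟩
  · rintro j a b (⟨h, -⟩ | ⟨-, -, h⟩)
    · omega
    · have := hc a; have := hc b; omega
  · rintro j a b b' (⟨h1, h2, -, h3⟩ | ⟨h1, h2, h3⟩) (⟨h1', h2', -, h3'⟩ | ⟨h1', h2', h3'⟩)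
    · exact hf a b b' h2 h2' (h3.trans h3'.symm)
    · omega
    · omega
    -- As both edges are answered, `b`, `a`, `b'` is a path of length two, and equal sums give its
    -- ends the same colour.
    · exact hc' a b b' (by tauto) (by tauto) (by omega)
  · rintro j a (⟨-, h, -⟩ | ⟨-, h, -⟩)
    · exact hirr a h
    · exact hirr a (by tauto)
  · rintro i j a b (⟨h1, h2, h3, h4⟩ | ⟨h1, h2, h4⟩) (⟨h1', h2', h3', h4'⟩ | ⟨h1', h2', h4'⟩)
    · omega
    · have := ho a b h2; tauto
    · have := ho a b h2'; tauto
    · omega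
  · rintro j a b hj (⟨-, h1, h2, -⟩ | ⟨h, -⟩)
    · have := ho a b h1; tauto
    · omega
  · rintro j a b hj (⟨h, -⟩ | ⟨-, h1, h2⟩)
    · omega
    · exact Or.inr ⟨hj, by tauto, by omega⟩
  · intro a b
    constructor
    · rintro ⟨j, h⟩; tauto
    · have hex : ∀ a b, o a b → ∃ j, (j < K ∧ o a b ∧ ¬ w b a ∧ f a b = j) ∨
          (K ≤ j ∧ (o a b ∧ w b a ∨ o b a ∧ w a b) ∧ c a + c b + K = j) := fun a b h => by
        by_cases hwb : w b a
        · exact ⟨_, Or.inr ⟨Nat.le_add_left _ _, Or.inl ⟨h, hwb⟩, rfl⟩⟩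
        · exact ⟨_, Or.inl ⟨hfK a b h, h, hwb, rfl⟩⟩
      rintro (h | h)
      · obtain ⟨j, hj⟩ := hex a b h; exact ⟨j, Or.inl hj⟩
      · obtain ⟨j, hj⟩ := hex b a h; exact ⟨j, Or.inr hj⟩
  · intro a b
    constructor
    · rintro (h | ⟨j, h⟩) <;> tauto
    · rintro (h | h)
      · exact Or.inl h
      · by_cases hwb : w b a
        · exact Or.inr ⟨_, Or.inr ⟨Nat.le_add_left _ _, Or.inl ⟨h, hwb⟩, rfl⟩⟩
        · exact Or.inr ⟨_, Or.inl ⟨hfK a b h, h, hwb, rfl⟩⟩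

/-! ## Rewiring -/

/-- An injective list of pairs of equivalent elements extends to a permutation that preserves the
equivalence and moves no other element. -/
theorem exists_perm_of_pairs {V : Type u} (r : Setoid V) (l : List (V × V))
    (h1 : (l.map Prod.fst).Nodup) (h2 : (l.map Prod.snd).Nodup)
    (hr : ∀ p ∈ l, r p.1 p.2) :
    ∃ π : Equiv.Perm V, (∀ p ∈ l, π p.1 = p.2) ∧ (∀ x, r (π x) x) ∧
      ∀ x, (∀ p ∈ l, x ≠ p.1 ∧ x ≠ p.2) → π x = x := by
  classical
  induction l with
  | nil => exact ⟨1, by simp, fun x => r.refl x, by simp⟩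
  | cons p l ih =>
    simp only [List.map_cons, List.nodup_cons, List.mem_map, not_exists, not_and] at h1 h2
    obtain ⟨π, hπ, hπr, hπf⟩ := ih h1.2 h2.2 fun p hp => hr p (List.mem_cons_of_mem _ hp)
    have hp : r p.1 p.2 := hr p List.mem_cons_self
    have hw : r (π p.1) p.2 := r.trans (hπr p.1) hp
    -- The swap corrects the value at `p.1`. Neither of the swapped elements is the target of an
    -- earlier pair, so the earlier values remain.
    refine ⟨π.trans (Equiv.swap (π p.1) p.2), ?_, fun x => ?_, fun x hx => ?_⟩
    · intro q hq
      rcases List.mem_cons.1 hq with rfl | hq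
      · simp
      · rw [Equiv.trans_apply, hπ q hq, Equiv.swap_apply_of_ne_of_ne]
        · rw [← hπ q hq]
          exact fun h => h1.1 q hq (π.injective h)
        · exact fun h => h2.1 q hq h
    · refine r.trans ?_ (hπr x)
      rw [Equiv.trans_apply]
      by_cases hx1 : π x = π p.1
      · rw [hx1, Equiv.swap_apply_left]; exact r.symm hw
      · by_cases hx2 : π x = p.2
        · rw [hx2, Equiv.swap_apply_right]; exact hw
        · rw [Equiv.swap_apply_of_ne_of_ne hx1 hx2]
    · have hx' := hx p List.mem_cons_self
      have hπx : π x = x := hπf x fun q hq => hx q (List.mem_cons_of_mem _ hq)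
      rw [Equiv.trans_apply, hπx, Equiv.swap_apply_of_ne_of_ne _ hx'.2]
      intro h
      exact hx'.1 (π.injective (hπx.trans h))

/-- Let `h` and `g` be two systems of partial functions with the same domains and with equivalent
values, where `g` is part of a relation `msg` that, up to equivalence, has no two ends of a path of
length two in common.  Then the pairs of elements can be replaced by equivalent pairs
`(s x y, s y x)` such that `g` turns into `h`, and the successors of each element `x` in a relation
that is part of `msg` are merely permuted, by some `σ x`. -/
theorem exists_rewiring {V : Type u} [Finite V] (r : Setoid V) (J : ℕ) (sym : ℕ → Prop)
    (h g : ℕ → V → V → Prop) (msg : V → V → Prop)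
    (hfun : ∀ j < J, ∀ a b b', h j a b → h j a b' → b = b')
    (gfun : ∀ j < J, ∀ a b b', g j a b → g j a b' → b = b')
    (hirr : ∀ j < J, ∀ a b, h j a b → a ≠ b)
    (girr : ∀ j < J, ∀ a b, g j a b → a ≠ b)
    (hdisj : ∀ j < J, ∀ i < j, ∀ a b, h j a b → ¬ h i a b)
    (gdisj : ∀ j < J, ∀ i < j, ∀ a b, g j a b → ¬ g i a b)
    (hdom : ∀ j < J, ∀ a, (∃ b, h j a b) ↔ ∃ b, g j a b)
    (hr : ∀ j < J, ∀ a b b', h j a b → g j a b' → r b' b)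
    (hsym : ∀ j < J, sym j → ∀ a b, h j a b → h j b a)
    (gsym : ∀ j < J, sym j → ∀ a b, g j a b → g j b a)
    (hdir : ∀ j < J, ¬ sym j → ∀ i < J, ∀ a b, h j a b → ¬ h i b a)
    (gdir : ∀ j < J, ¬ sym j → ∀ a b, g j a b → ¬ msg b a)
    (gmsg : ∀ j < J, ∀ a b, g j a b → msg a b)
    (hmsg : ∀ a b b', msg b a → msg a b' → r b b' → b = b') :
    ∃ (s : V → V → V) (σ : V → Equiv.Perm V),
      (∀ x y, r (s x y) x) ∧ (∀ x y, s x y = s y x ↔ x = y) ∧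
      (∀ j < J, ∀ x y, g j x (σ x y) ↔ h j x y) ∧
      ∀ E : V → V → Prop, (∀ x y, E x y → msg x y) →
        (∀ j < J, sym j → ∀ x y x' y', g j x y → g j x' y' → r x x' → (E x y ↔ E x' y')) →
        ∀ x y, E (s x y) (s y x) ↔ E x (σ x y) := by
  classical
  have hdisj' : ∀ j < J, ∀ i < J, ∀ a b, h j a b → h i a b → i = j := by
    intro j hj i hi a b h1 h2
    rcases lt_trichotomy i j with hij | hij | hij
    · exact absurd h2 (hdisj j hj i hij a b h1)
    · exact hij
    · exact absurd h1 (hdisj i hi j hij a b h2)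
  have gdisj' : ∀ j < J, ∀ i < J, ∀ a b, g j a b → g i a b → i = j := by
    intro j hj i hi a b h1 h2
    rcases lt_trichotomy i j with hij | hij | hij
    · exact absurd h2 (gdisj j hj i hij a b h1)
    · exact hij
    · exact absurd h1 (gdisj i hi j hij a b h2)
  -- The permutations.
  have hperm : ∀ x, ∃ σ : Equiv.Perm V, (∀ j < J, ∀ a b, g j x a → h j x b → σ b = a) ∧
      (∀ y, r (σ y) y) ∧ ∀ y, σ y ≠ y → ∃ j < J, g j x y ∨ h j x y := by
    intro x
    -- For each index defined at `x`, the `g`-successor is paired with the `h`-successor;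
    -- disjointness of the links makes both lists injective. The required permutation is the inverse
    -- of the one obtained from these pairs.
    let I := (List.range J).filter fun j => ∃ b, g j x b
    have hI : ∀ j ∈ I, j < J ∧ (∃ b, g j x b) ∧ ∃ b, h j x b := by
      intro j hj
      simp only [I, List.mem_filter, List.mem_range, decide_eq_true_eq] at hj
      exact ⟨hj.1, hj.2, (hdom j hj.1 x).2 hj.2⟩
    have hval : ∀ j, ∃ p : V × V, j ∈ I → g j x p.1 ∧ h j x p.2 := by
      intro j
      by_cases hj : j ∈ I
      · obtain ⟨-, ⟨b, hb⟩, ⟨b', hb'⟩⟩ := hI j hj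
        exact ⟨(b, b'), fun _ => ⟨hb, hb'⟩⟩
      · exact ⟨(x, x), fun h => absurd h hj⟩
    choose p hp using hval
    have hnd : I.Nodup := List.nodup_range.filter _
    obtain ⟨π, hπ, hπr, hπf⟩ := exists_perm_of_pairs r (I.map p)
      (by
        rw [List.map_map, List.nodup_map_iff_inj_on hnd]
        intro i hi j hj hij
        refine gdisj' j (hI j hj).1 i (hI i hi).1 x (p j).1 (hp j hj).1 ?_
        have := (hp i hi).1
        simp only [Function.comp] at hij
        rwa [hij] at this)
      (by
        rw [List.map_map, List.nodup_map_iff_inj_on hnd]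
        intro i hi j hj hij
        refine hdisj' j (hI j hj).1 i (hI i hi).1 x (p j).2 (hp j hj).2 ?_
        have := (hp i hi).2
        simp only [Function.comp] at hij
        rwa [hij] at this)
      (by
        intro q hq
        obtain ⟨j, hj, rfl⟩ := List.mem_map.1 hq
        exact hr j (hI j hj).1 x _ _ (hp j hj).2 (hp j hj).1)
    refine ⟨π.symm, fun j hj a b ha hb => ?_, fun y => ?_, fun y hy => ?_⟩
    · have hjI : j ∈ I := by simpa [I, hj] using ⟨a, ha⟩
      have h1 := gfun j hj x _ _ ha (hp j hjI).1
      have h2 := hfun j hj x _ _ hb (hp j hjI).2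
      rw [h1, h2, ← hπ (p j) (List.mem_map_of_mem hjI), Equiv.symm_apply_apply]
    · have := hπr (π.symm y)
      rw [Equiv.apply_symm_apply] at this
      exact r.symm this
    · by_contra! hcon
      refine hy ?_
      rw [Equiv.symm_apply_eq]
      refine (hπf y fun q hq => ?_).symm
      obtain ⟨j, hj, rfl⟩ := List.mem_map.1 hq
      have hj' := (hI j hj).1
      refine ⟨fun h => (hcon j hj').1 (h ▸ (hp j hj).1), fun h => (hcon j hj').2 (h ▸ (hp j hj).2)⟩
  choose σ hσ hσr hσm using hperm
  have hσx : ∀ x, σ x x = x := fun x => by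
    by_contra hx
    obtain ⟨j, hj, h1 | h1⟩ := hσm x x hx
    · exact girr j hj x x h1 rfl
    · exact hirr j hj x x h1 rfl
  have hσg : ∀ j < J, ∀ x y, h j x y → g j x (σ x y) := fun j hj x y hy => by
    obtain ⟨a, ha⟩ := (hdom j hj x).1 ⟨y, hy⟩
    rw [hσ x j hj a y ha hy]; exact ha
  have hσh : ∀ j < J, ∀ x y, g j x (σ x y) → h j x y := fun j hj x y hy => by
    obtain ⟨b, hb⟩ := (hdom j hj x).2 ⟨_, hy⟩
    have := hσ x j hj _ b hy hb
    rwa [(σ x).injective this] at hb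
  -- A moved element that sends a message to `y` is a symmetric neighbour of `y`.
  have claimA : ∀ x y, (∃ j < J, g j y x ∨ h j y x) → msg x y → ∃ j < J, sym j ∧ g j y x := by
    rintro x y ⟨j, hj, h1⟩ hxy
    have h2 : g j y x := by
      rcases h1 with h1 | h1
      · exact h1
      · have h2 := hσg j hj y x h1
        rw [hmsg y x _ hxy (gmsg j hj _ _ h2) (r.symm (hσr y x))]
        exact h2
    refine ⟨j, hj, ?_, h2⟩
    by_contra hs
    exact gdir j hj hs y x h2 hxy
  have hmove : ∀ x y, σ y x ≠ x → σ y (σ y x) ≠ σ y x := fun x y hx h => hx ((σ y).injective h)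
  -- The element `σ y x` is itself moved by `σ y`, so `claimA` applies to it.
  have claimB : ∀ x y, σ y x ≠ x → msg (σ y x) y →
      ∃ j < J, sym j ∧ g j y (σ y x) ∧ h j y x := by
    intro x y hx hm
    obtain ⟨j, hj, hs, h1⟩ := claimA (σ y x) y (hσm y _ (hmove x y hx)) hm
    exact ⟨j, hj, hs, h1, hσh j hj y x h1⟩
  -- Here `x` exchanges messages with `y` in both directions. A message between `y` and the
  -- equivalent element `σ y x` would complete a path of length two with equivalent ends, forcing `σ
  -- y x = x`.
  have claimC : ∀ x y, σ y x ≠ x → msg x y →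
      ¬ msg y (σ y x) ∧ ¬ msg (σ y x) y ∧ σ x y ≠ y := by
    intro x y hx hm
    obtain ⟨j, hj, hs, h1⟩ := claimA x y (hσm y x hx) hm
    have h2 : msg y x := gmsg j hj y x h1
    refine ⟨fun h3 => hx (hmsg y x _ hm h3 (r.symm (hσr y x))).symm,
      fun h3 => hx (hmsg y _ x h3 h2 (hσr y x)), fun hy => hx ?_⟩
    have h3 : g j x y := gsym j hj hs y x h1
    have h4 : h j x y := hσh j hj x y (by rwa [hy])
    exact hσ y j hj x x h1 (hsym j hj hs x y h4)
  obtain ⟨n, ⟨e⟩⟩ := Finite.exists_equiv_fin V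
  -- Seen from `x`, the pair should become `(x, σ x y)`; seen from `y`, it should become `(σ y x,
  -- y)`. The end that asks for a change is obeyed; if both do, the enumeration `e` decides, so that
  -- `s x y` and `s y x` follow the same end.
  let s : V → V → V := fun x y => if σ x y ≠ y ∧ (σ y x = x ∨ e x < e y) then x else σ y x
  have hs1 : ∀ x y, σ x y ≠ y → (σ y x = x ∨ e x < e y) → s x y = x ∧ s y x = σ x y := by
    intro x y h1 h2
    refine ⟨if_pos ⟨h1, h2⟩, if_neg ?_⟩
    rintro ⟨h3, h4⟩
    rcases h4 with h4 | h4
    · exact h1 h4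
    · rcases h2 with h2 | h2
      · exact h3 h2
      · exact lt_asymm h2 h4
  have hs2 : ∀ x y, ¬ (σ x y ≠ y ∧ (σ y x = x ∨ e x < e y)) → s x y = σ y x ∧ s y x = y := by
    intro x y h1
    refine ⟨if_neg h1, ?_⟩
    by_cases h2 : σ y x = x
    · have h3 : σ x y = y := by
        by_contra h3; exact h1 ⟨h3, Or.inl h2⟩
      simp only [s]; split_ifs
      · rfl
      · exact h3
    · by_cases h3 : σ x y = y
      · exact if_pos ⟨h2, Or.inl h3⟩
      · refine if_pos ⟨h2, Or.inr ?_⟩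
        have h4 : ¬ e x < e y := fun h4 => h1 ⟨h3, Or.inr h4⟩
        have h5 : e x ≠ e y := fun h => by
          have := e.injective h
          subst this
          exact h2 (hσx x)
        exact lt_of_le_of_ne (not_lt.1 h4) h5.symm
  refine ⟨s, σ, fun x y => ?_, fun x y => ⟨fun hxy => ?_, fun hxy => by rw [hxy]⟩,
    fun j hj x y => ⟨hσh j hj x y, hσg j hj x y⟩, ?_⟩
  · simp only [s]; split_ifs
    · exact r.refl x
    · exact hσr y x
  · by_cases hc : σ x y ≠ y ∧ (σ y x = x ∨ e x < e y)
    · obtain ⟨h1, h2⟩ := hs1 x y hc.1 hc.2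
      rw [h1, h2] at hxy
      exact (σ x).injective ((hσx x).trans hxy)
    · obtain ⟨h1, h2⟩ := hs2 x y hc
      rw [h1, h2] at hxy
      exact (σ y).injective (hxy.trans (hσx y).symm)
  · intro E hE hEs x y
    by_cases hc : σ x y ≠ y ∧ (σ y x = x ∨ e x < e y)
    · obtain ⟨h1, h2⟩ := hs1 x y hc.1 hc.2
      rw [h1, h2]
    · obtain ⟨h1, h2⟩ := hs2 x y hc
      rw [h1, h2]
      by_cases hy : σ x y = y
      · rw [hy]
        by_cases hx : σ y x = x
        · rw [hx]
        -- Only `y` asks for a change, and `E` fails on both candidate pairs. A message from `σ y x`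
        -- to `y` would make `x` a symmetric `h`-neighbour of `y`; as `σ x` fixes `y`, the same link
        -- would join them in `g`, leaving nothing to move.
        · refine iff_of_false (fun h3 => ?_) (fun h3 => (claimC x y hx (hE _ _ h3)).2.2 hy)
          obtain ⟨j, hj, hs, h4, h5⟩ := claimB x y hx (hE _ _ h3)
          have h6 := hσg j hj x y (hsym j hj hs _ _ h5)
          rw [hy] at h6
          exact hx (gfun j hj y _ _ h4 (gsym j hj hs _ _ h6))
      · have hx : σ y x ≠ x := fun hx => hc ⟨hy, Or.inl hx⟩
        -- Both ends ask for a change. Along a symmetric link both candidate pairs belong to the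
        -- same link of `g` and have equivalent first elements, so `E` has the same value on them.
        -- Without such a link, `E` fails on both.
        by_cases hsy : ∃ j < J, sym j ∧ h j x y
        · obtain ⟨j, hj, hs, h3⟩ := hsy
          exact hEs j hj hs _ _ _ _ (gsym j hj hs _ _ (hσg j hj y x (hsym j hj hs _ _ h3)))
            (hσg j hj x y h3) (hσr y x)
        · have notdir : ∀ x y, σ y x ≠ x → σ x y ≠ y → (¬ ∃ j < J, sym j ∧ h j x y) →
              ∀ j < J, ¬ h j x y := by
            intro x y hx hy hsy j hj h3
            have hs : ¬ sym j := fun hs => hsy ⟨j, hj, hs, h3⟩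
            obtain ⟨i, hi, h4 | h4⟩ := hσm y x hx
            · exact hy (hmsg x y _ (gmsg i hi _ _ h4) (gmsg j hj _ _ (hσg j hj x y h3))
                (r.symm (hσr x y))).symm
            · exact hdir j hj hs i hi x y h3 h4
          have hsy' : ¬ ∃ j < J, sym j ∧ h j y x := fun ⟨j, hj, hs, h3⟩ =>
            hsy ⟨j, hj, hs, hsym j hj hs _ _ h3⟩
          refine iff_of_false (fun h3 => ?_) (fun h3 => ?_)
          · obtain ⟨j, hj, hs, -, h5⟩ := claimB x y hx (hE _ _ h3)
            exact hsy' ⟨j, hj, hs, h5⟩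
          · obtain ⟨i, hi, h4 | h4⟩ := hσm y x hx
            · exact (claimC y x hy (gmsg i hi _ _ h4)).1 (hE _ _ h3)
            · exact notdir y x hy hx hsy' i hi h4

/-! ## Tree-width and orientations -/

namespace SimpleGraph

variable {V : Type u}

/-- In a tree, let `s` be a vertex of minimal distance to the root `r` in a connected set `S`, and
let `u` be a vertex of a connected set `S'` that meets `S`.  If `u` is at most as far from `r` as
`s`, then `s` belongs to `S'`. -/
theorem IsTree.mem_of_dist_le {ι : Type} {T : SimpleGraph ι} (hT : T.IsTree) (r : ι)
    {S S' : Set ι} (hS : (T.induce S).Preconnected) (hS' : (T.induce S').Preconnected)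
    {s t u : ι} (hs : s ∈ S) (hmin : ∀ x ∈ S, T.dist s r ≤ T.dist x r) (ht : t ∈ S) (ht' : t ∈ S')
    (hu : u ∈ S') (hus : T.dist u r ≤ T.dist s r) : s ∈ S' := by
  classical
  by_contra hs'
  -- On a shortest walk, every vertex other than the start is strictly closer to the end.
  have hlen : ∀ x y z, ∀ p : T.Walk x y, p.length = T.dist x y → z ∈ p.support →
      z = x ∨ T.dist z y < T.dist x y := by
    intro x y z p hp hz
    by_contra! hcon
    obtain ⟨hzx, hd⟩ := hcon
    have h1 : T.dist z y ≤ (p.dropUntil z hz).length := dist_le _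
    have h2 := congrArg Walk.length (p.take_spec hz)
    rw [Walk.length_append] at h2
    have h3 : (p.takeUntil z hz).length = 0 := by omega
    exact hzx (Walk.eq_of_length_eq_zero h3).symm
  obtain ⟨p1⟩ := hS ⟨t, ht⟩ ⟨s, hs⟩
  obtain ⟨q, hq⟩ := hT.connected.exists_walk_length_eq_dist s r
  obtain ⟨p2⟩ := hS' ⟨t, ht'⟩ ⟨u, hu⟩
  obtain ⟨q', hq'⟩ := hT.connected.exists_walk_length_eq_dist u r
  let w1 : T.Walk t s := p1.map (Embedding.induce S).toHom
  let w2 : T.Walk t u := p2.map (Embedding.induce S').toHom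
  have hw1 : ∀ x ∈ w1.bypass.support, x ∈ S := fun x hx => by
    have := w1.support_bypass_subset_support hx
    obtain ⟨y, -, rfl⟩ := List.mem_map.1 (Walk.support_map _ _ ▸ this)
    exact y.2
  have hw2 : ∀ x ∈ w2.support, x ∈ S' := fun x hx => by
    obtain ⟨y, -, rfl⟩ := List.mem_map.1 (Walk.support_map _ _ ▸ hx)
    exact y.2
  -- The first half stays in `S`, hence no closer to `r` than `s`, while the second half gets
  -- strictly closer after `s`; so they meet only in `s`.
  have hpath : (w1.bypass.append q).IsPath := by
    rw [Walk.isPath_def, Walk.support_append]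
    have hqp : q.IsPath := Walk.isPath_of_length_eq_dist q hq
    have hqn := hqp.support_nodup
    rw [← Walk.cons_tail_support] at hqn
    refine List.Nodup.append (w1.bypass_isPath.support_nodup) (List.nodup_cons.1 hqn).2 ?_
    intro x hx hx'
    have h1 := hmin x (hw1 x hx)
    rcases hlen s r x q hq (List.mem_of_mem_tail hx') with h2 | h2
    · subst h2
      exact (List.nodup_cons.1 hqn).1 hx'
    · omega
  -- Paths in a tree are unique, so the route from `t` to `r` through `u` also passes `s`. It does
  -- so inside `S'`: beyond `u` it is too close to `r`.
  have huniq := (hT.isAcyclic.subsingleton_path t r).elim ⟨_, hpath⟩ ⟨_, (w2.append q').bypass_isPath⟩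
  have hmem : s ∈ (w2.append q').support := by
    apply Walk.support_bypass_subset_support
    have := congrArg Subtype.val huniq
    dsimp only at this
    rw [← this]
    simp
  rw [Walk.mem_support_append_iff] at hmem
  rcases hmem with hmem | hmem
  · exact hs' (hw2 s hmem)
  · rcases hlen u r s q' hq' hmem with h2 | h2
    · exact hs' (h2 ▸ hu)
    · omega

/-- Root the tree and orient each edge towards the end whose topmost bag is closer to the root,
breaking ties by an enumeration. The out-neighbours of `a` then lie in the topmost bag of `a`, which
has at most `k` elements besides `a`. -/
theorem TreewidthLE.isKBounded [Finite V] {G : SimpleGraph V} {k : ℕ} (h : G.TreewidthLE k) :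
    G.IsKBounded (k + 1) := by
  obtain ⟨ι, _, T, bag, hT, hcov, hedge, hconn, hcard⟩ := h
  obtain ⟨r⟩ := hT.connected.nonempty
  have htop : ∀ v, ∃ t, v ∈ bag t ∧ ∀ t', v ∈ bag t' → T.dist t r ≤ T.dist t' r := fun v =>
    (Set.toFinite {t | v ∈ bag t}).exists_minimalFor (fun t => T.dist t r) _ (hcov v) |>.imp
      fun t ht => ⟨ht.1, fun t' ht' => (le_total _ _).elim id fun h => ht.2 ht' h⟩
  choose top htop hmin using htop
  obtain ⟨n, ⟨e⟩⟩ := Finite.exists_equiv_fin V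
  let key : V → ℕ ×ₗ Fin n := fun v => toLex (T.dist (top v) r, e v)
  have hkey : Function.Injective key := fun v w hvw => by
    have := congrArg (fun p => (ofLex p).2) hvw
    exact e.injective this
  refine ⟨fun a b => G.Adj a b ∧ key b < key a, fun a b => ⟨fun hab => ?_, ?_⟩,
    fun a b h1 h2 => lt_asymm h1.2 h2.2, fun a => ?_⟩
  · rcases lt_trichotomy (key a) (key b) with h | h | h
    · exact Or.inr ⟨hab.symm, h⟩
    · exact absurd (hkey h) hab.ne
    · exact Or.inl ⟨hab, h⟩
  · rintro (h | h)
    · exact h.1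
    · exact h.1.symm
  · have hsub : {b | G.Adj a b ∧ key b < key a} ⊆ bag (top a) \ {a} := by
      rintro b ⟨hab, hlt⟩
      obtain ⟨t, hta, htb⟩ := hedge a b hab
      refine ⟨?_, hab.ne'⟩
      have hle : T.dist (top b) r ≤ T.dist (top a) r := by
        rw [Prod.Lex.lt_iff] at hlt
        rcases hlt with h | h
        · exact le_of_lt h
        · exact le_of_eq h.1
      exact hT.mem_of_dist_le r (hconn a) (hconn b) (htop a) (hmin a) hta htb (htop b) hle
    have h1 := Set.encard_sdiff_singleton_add_one (htop a)
    have h2 := hcard (top a)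
    rw [← h1] at h2
    have h3 : (bag (top a) \ {a}).encard ≤ k :=
      (ENat.add_le_add_iff_right (by simp)).1 h2
    refine lt_of_le_of_lt ((Set.encard_le_encard hsub).trans h3) ?_
    exact_mod_cast Nat.lt_succ_self k

theorem IsKBounded.mono {G : SimpleGraph V} {k l : ℕ} (h : G.IsKBounded k) (hkl : k ≤ l) :
    G.IsKBounded l := by
  obtain ⟨o, h1, h2, h3⟩ := h
  exact ⟨o, h1, h2, fun a => (h3 a).trans_le (by exact_mod_cast hkl)⟩

end SimpleGraph

/-! ## Derived connectives -/

namespace Formula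

def imp (φ ψ : Formula) : Formula := neg (and φ (neg ψ))

def iff (φ ψ : Formula) : Formula := and (imp φ ψ) (imp ψ φ)

def or (φ ψ : Formula) : Formula := neg (and (neg φ) (neg ψ))

def all (x : ℕ) (φ : Formula) : Formula := neg (ex x (neg φ))

/-- There is at most one `x` with `φ`. -/
def atMostOne (x : ℕ) (φ : Formula) : Formula := neg (exGe 2 x φ)

/-- The conjunction of the formulas `f i` with `i` in a list. -/
def allOver (l : List ℕ) (f : ℕ → Formula) : Formula := l.foldr (fun i φ => and (f i) φ) (eq 0 0)

/-- The disjunction of the formulas `f i` with `i` in a list. -/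
def anyOver (l : List ℕ) (f : ℕ → Formula) : Formula := neg (allOver l fun i => neg (f i))

/-! ## Satisfaction over total interpretations -/

/-- Satisfaction of a formula under an interpretation of all symbols. -/
def Holds {V : Type u} (U : ℕ → V → Prop) (R : ℕ → V → V → Prop) :
    (e : ℕ → V) → (s : ℕ → Set V) → (r : ℕ → V → V → Prop) → Formula → Prop
  | e, _, _, .eq x y => e x = e y
  | e, _, _, .un P x => U P (e x)
  | e, _, _, .bin B x y => R B (e x) (e y)
  | e, s, _, .mem X x => e x ∈ s X
  | e, _, r, .mem₂ Z x y => r Z (e x) (e y)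
  | e, s, r, .neg φ => ¬ Holds U R e s r φ
  | e, s, r, .and φ ψ => Holds U R e s r φ ∧ Holds U R e s r ψ
  | e, s, r, .ex x φ => ∃ a : V, Holds U R (Function.update e x a) s r φ
  | e, s, r, .exGe n x φ => (n : ℕ∞) ≤ {a : V | Holds U R (Function.update e x a) s r φ}.encard
  | e, s, r, .exSet X φ => ∃ S : Set V, Holds U R e (Function.update s X S) r φ
  | e, s, r, .exSub Z B φ => ∃ T : V → V → Prop,
      (∀ a b, T a b → R B a b) ∧ Holds U R e s (Function.update r Z T) φ

section Holds

variable {V : Type u} {U U' : ℕ → V → Prop} {R R' : ℕ → V → V → Prop}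
  {e : ℕ → V} {s : ℕ → Set V} {r : ℕ → V → V → Prop} {φ ψ : Formula}

@[simp] theorem holds_eq {x y} : Holds U R e s r (eq x y) ↔ e x = e y := Iff.rfl
@[simp] theorem holds_un {P x} : Holds U R e s r (un P x) ↔ U P (e x) := Iff.rfl
@[simp] theorem holds_bin {B x y} : Holds U R e s r (bin B x y) ↔ R B (e x) (e y) := Iff.rfl
@[simp] theorem holds_neg : Holds U R e s r (neg φ) ↔ ¬ Holds U R e s r φ := Iff.rfl
@[simp] theorem holds_and :
    Holds U R e s r (and φ ψ) ↔ Holds U R e s r φ ∧ Holds U R e s r ψ := Iff.rfl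
@[simp] theorem holds_ex {x} :
    Holds U R e s r (ex x φ) ↔ ∃ a : V, Holds U R (Function.update e x a) s r φ := Iff.rfl
@[simp] theorem holds_exGe {n x} : Holds U R e s r (exGe n x φ) ↔
    (n : ℕ∞) ≤ {a : V | Holds U R (Function.update e x a) s r φ}.encard := Iff.rfl

@[simp] theorem holds_imp :
    Holds U R e s r (imp φ ψ) ↔ (Holds U R e s r φ → Holds U R e s r ψ) := by
  simp [imp]

@[simp] theorem holds_iff :
    Holds U R e s r (iff φ ψ) ↔ (Holds U R e s r φ ↔ Holds U R e s r ψ) := by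
  simp [iff, iff_iff_implies_and_implies]

@[simp] theorem holds_or :
    Holds U R e s r (or φ ψ) ↔ (Holds U R e s r φ ∨ Holds U R e s r ψ) := by
  simp [or, or_iff_not_and_not]

@[simp] theorem holds_all {x} :
    Holds U R e s r (all x φ) ↔ ∀ a : V, Holds U R (Function.update e x a) s r φ := by
  simp [all]

@[simp] theorem holds_atMostOne {x} : Holds U R e s r (atMostOne x φ) ↔
    ∀ a b : V, Holds U R (Function.update e x a) s r φ →
      Holds U R (Function.update e x b) s r φ → a = b := by
  rw [atMostOne, holds_neg, holds_exGe, not_le]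
  have : ∀ n : ℕ∞, n < (2 : ℕ) ↔ n ≤ 1 := fun n => by
    rw [show ((2 : ℕ) : ℕ∞) = 1 + 1 by norm_num, ENat.lt_add_one_iff (by simp)]
  rw [this, Set.encard_le_one_iff]
  rfl

@[simp] theorem holds_allOver {l f} :
    Holds U R e s r (allOver l f) ↔ ∀ i ∈ l, Holds U R e s r (f i) := by
  induction l <;> simp_all [allOver]

@[simp] theorem holds_anyOver {l f} :
    Holds U R e s r (anyOver l f) ↔ ∃ i ∈ l, Holds U R e s r (f i) := by
  simp [anyOver]

theorem holds_congr {C : Vocab} (hU : ∀ P ∈ C.un, ∀ a, U P a ↔ U' P a)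
    (hR : ∀ B ∈ C.bin, ∀ a b, R B a b ↔ R' B a b) (hφ : φ.Over C) :
    Holds U R e s r φ ↔ Holds U' R' e s r φ := by
  induction φ generalizing e s r with
  | eq x y => rfl
  | un P x => exact hU P hφ _
  | bin B x y => exact hR B hφ _ _
  | mem X x => rfl
  | mem₂ Z x y => rfl
  | neg φ ih => exact not_congr (ih hφ)
  | and φ ψ ih1 ih2 => exact and_congr (ih1 hφ.1) (ih2 hφ.2)
  | ex x φ ih => exact exists_congr fun a => ih hφ
  | exGe n x φ ih =>
    have : {a : V | Holds U R (Function.update e x a) s r φ} =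
        {a : V | Holds U' R' (Function.update e x a) s r φ} := Set.ext fun a => ih hφ
    rw [holds_exGe, holds_exGe, this]
  | exSet X φ ih => exact exists_congr fun S => ih hφ
  | exSub Z B φ ih =>
    exact exists_congr fun T => and_congr
      (forall₂_congr fun a b => imp_congr_right fun _ => hR B hφ.1 a b) (ih hφ.2)

/-- A formula of the two-variable fragment depends on the values of `0` and `1` only. -/
theorem holds_congr_assignment (hφ : φ.IsC2) {e' s' r'} (h0 : e 0 = e' 0) (h1 : e 1 = e' 1) :
    Holds U R e s r φ ↔ Holds U R e' s' r' φ := by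
  have hv : ∀ (e e' : ℕ → V), e 0 = e' 0 → e 1 = e' 1 → ∀ x < 2, e x = e' x := by
    intro e e' h0 h1 x hx
    interval_cases x <;> assumption
  have hu : ∀ (e e' : ℕ → V) (a : V) (x y : ℕ), y < 2 → e 0 = e' 0 → e 1 = e' 1 →
      Function.update e x a y = Function.update e' x a y := by
    intro e e' a x y hy h0 h1
    rw [Function.update_apply, Function.update_apply, hv e e' h0 h1 y hy]
  induction φ generalizing e e' with
  | eq x y => simp [hv e e' h0 h1 _ hφ.1, hv e e' h0 h1 _ hφ.2]
  | un P x => simp [hv e e' h0 h1 _ hφ]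
  | bin B x y => simp [hv e e' h0 h1 _ hφ.1, hv e e' h0 h1 _ hφ.2]
  | mem X x => exact hφ.elim
  | mem₂ Z x y => exact hφ.elim
  | neg φ ih => exact not_congr (ih hφ h0 h1)
  | and φ ψ ih1 ih2 => exact and_congr (ih1 hφ.1 h0 h1) (ih2 hφ.2 h0 h1)
  | ex x φ ih =>
    exact exists_congr fun a => ih hφ.2 (hu _ _ a x 0 (by simp) h0 h1) (hu _ _ a x 1 (by simp) h0 h1)
  | exGe n x φ ih =>
    have : {a : V | Holds U R (Function.update e x a) s r φ} =
        {a : V | Holds U R (Function.update e' x a) s' r' φ} := Set.ext fun a =>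
      ih hφ.2 (hu _ _ a x 0 (by simp) h0 h1) (hu _ _ a x 1 (by simp) h0 h1)
    rw [holds_exGe, holds_exGe, this]
  | exSet X φ ih => exact hφ.elim
  | exSub Z B φ ih => exact hφ.elim

/-- The universal closure of a formula holds under all assignments iff the formula does. -/
theorem forall_holds_all {x : ℕ} :
    (∀ e s r, Holds U R e s r (all x φ)) ↔ ∀ e s r, Holds U R e s r φ := by
  simp only [holds_all]
  exact ⟨fun h e s r => by simpa using h e s r (e x), fun h e s r a => h _ s r⟩

end Holds

/-! ## Syntactic side conditions -/

theorem imp_over {C φ ψ} : (imp φ ψ).Over C ↔ φ.Over C ∧ ψ.Over C := Iff.rfl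
theorem iff_over {C φ ψ} : (iff φ ψ).Over C ↔ φ.Over C ∧ ψ.Over C := by
  simp only [iff, Over, imp_over]; tauto
theorem or_over {C φ ψ} : (or φ ψ).Over C ↔ φ.Over C ∧ ψ.Over C := Iff.rfl
theorem atMostOne_over {C x φ} : (atMostOne x φ).Over C ↔ φ.Over C := Iff.rfl
theorem allOver_over {C l f} : (allOver l f).Over C ↔ ∀ i ∈ l, (f i).Over C := by
  induction l <;> simp_all [allOver, Over]
theorem anyOver_over {C l f} : (anyOver l f).Over C ↔ ∀ i ∈ l, (f i).Over C := by
  simp [anyOver, Over, allOver_over]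

theorem imp_isMSO {φ ψ} : (imp φ ψ).IsMSO ↔ φ.IsMSO ∧ ψ.IsMSO := Iff.rfl
theorem iff_isMSO {φ ψ} : (iff φ ψ).IsMSO ↔ φ.IsMSO ∧ ψ.IsMSO := by
  simp only [iff, IsMSO, imp_isMSO]; tauto
theorem or_isMSO {φ ψ} : (or φ ψ).IsMSO ↔ φ.IsMSO ∧ ψ.IsMSO := Iff.rfl
theorem allOver_isMSO {l f} : (allOver l f).IsMSO ↔ ∀ i ∈ l, (f i).IsMSO := by
  induction l <;> simp_all [allOver, IsMSO]
theorem anyOver_isMSO {l f} : (anyOver l f).IsMSO ↔ ∀ i ∈ l, (f i).IsMSO := by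
  simp [anyOver, IsMSO, allOver_isMSO]

theorem imp_isC2 {φ ψ} : (imp φ ψ).IsC2 ↔ φ.IsC2 ∧ ψ.IsC2 := Iff.rfl
theorem iff_isC2 {φ ψ} : (iff φ ψ).IsC2 ↔ φ.IsC2 ∧ ψ.IsC2 := by
  simp only [iff, IsC2, imp_isC2]; tauto
theorem or_isC2 {φ ψ} : (or φ ψ).IsC2 ↔ φ.IsC2 ∧ ψ.IsC2 := Iff.rfl
theorem atMostOne_isC2 {x φ} : (atMostOne x φ).IsC2 ↔ x < 2 ∧ φ.IsC2 := Iff.rfl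
theorem allOver_isC2 {l f} : (allOver l f).IsC2 ↔ ∀ i ∈ l, (f i).IsC2 := by
  induction l <;> simp_all [allOver, IsC2]
theorem anyOver_isC2 {l f} : (anyOver l f).IsC2 ↔ ∀ i ∈ l, (f i).IsC2 := by
  simp [anyOver, IsC2, allOver_isC2]

/-- No second order variable occurs in the formula, and all its element variables are less
than `m`. -/
def ElementsLT (m : ℕ) : Formula → Prop
  | eq x y => x < m ∧ y < m
  | un _ x => x < m
  | bin _ x y => x < m ∧ y < m
  | mem _ _ => False
  | mem₂ _ _ _ => False
  | neg φ => φ.ElementsLT m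
  | and φ ψ => φ.ElementsLT m ∧ ψ.ElementsLT m
  | ex x φ => x < m ∧ φ.ElementsLT m
  | exGe _ x φ => x < m ∧ φ.ElementsLT m
  | exSet _ _ => False
  | exSub _ _ _ => False

theorem imp_elementsLT {m φ ψ} :
    (imp φ ψ).ElementsLT m ↔ φ.ElementsLT m ∧ ψ.ElementsLT m := Iff.rfl
theorem iff_elementsLT {m φ ψ} :
    (iff φ ψ).ElementsLT m ↔ φ.ElementsLT m ∧ ψ.ElementsLT m := by
  simp only [iff, ElementsLT, imp_elementsLT]; tauto
theorem or_elementsLT {m φ ψ} :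
    (or φ ψ).ElementsLT m ↔ φ.ElementsLT m ∧ ψ.ElementsLT m := Iff.rfl
theorem allOver_elementsLT {m l f} (hm : 0 < m) :
    (allOver l f).ElementsLT m ↔ ∀ i ∈ l, (f i).ElementsLT m := by
  induction l <;> simp_all [allOver, ElementsLT]
theorem anyOver_elementsLT {m l f} (hm : 0 < m) :
    (anyOver l f).ElementsLT m ↔ ∀ i ∈ l, (f i).ElementsLT m := by
  simp [anyOver, ElementsLT, allOver_elementsLT hm]

theorem IsC2.elementsLT {φ : Formula} (h : φ.IsC2) : φ.ElementsLT 2 := by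
  induction φ <;> simp_all [IsC2, ElementsLT]

theorem ElementsLT.free {φ : Formula} {m : ℕ} (h : φ.ElementsLT m) :
    φ.freeEl ⊆ {x | x < m} ∧ φ.freeSet = ∅ ∧ φ.freeRel = ∅ := by
  induction φ with
  | eq x y => simp_all [ElementsLT, freeEl, freeSet, freeRel, Set.insert_subset_iff]
  | un P x => simp_all [ElementsLT, freeEl, freeSet, freeRel]
  | bin B x y => simp_all [ElementsLT, freeEl, freeSet, freeRel, Set.insert_subset_iff]
  | mem => exact h.elim
  | mem₂ => exact h.elim
  | neg φ ih => exact ih h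
  | and φ ψ ih1 ih2 =>
    obtain ⟨h1, h2, h3⟩ := ih1 h.1
    obtain ⟨h1', h2', h3'⟩ := ih2 h.2
    exact ⟨Set.union_subset h1 h1', by simp [freeSet, h2, h2'], by simp [freeRel, h3, h3']⟩
  | ex x φ ih => exact ⟨Set.sdiff_subset.trans (ih h.2).1, (ih h.2).2⟩
  | exGe n x φ ih => exact ⟨Set.sdiff_subset.trans (ih h.2).1, (ih h.2).2⟩
  | exSet => exact h.elim
  | exSub => exact h.elim

theorem ElementsLT.isSentence_all₃ {φ : Formula} (h : φ.ElementsLT 3) :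
    (all 0 (all 1 (all 2 φ))).IsSentence := by
  obtain ⟨h1, h2, h3⟩ := h.free
  refine ⟨?_, h2, h3⟩
  rw [Set.eq_empty_iff_forall_notMem]
  rintro x ⟨⟨⟨hx, hx2⟩, hx1⟩, hx0⟩
  have : x < 3 := h1 hx
  simp only [Set.mem_singleton_iff] at hx0 hx1 hx2
  omega

theorem ElementsLT.isSentence_all₂ {φ : Formula} (h : φ.ElementsLT 2) :
    (all 0 (all 1 φ)).IsSentence := by
  obtain ⟨h1, h2, h3⟩ := h.free
  refine ⟨?_, h2, h3⟩
  rw [Set.eq_empty_iff_forall_notMem]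
  rintro x ⟨⟨hx, hx1⟩, hx0⟩
  have : x < 2 := h1 hx
  simp only [Set.mem_singleton_iff] at hx0 hx1
  omega

theorem IsSentence.and {φ ψ : Formula} (h : φ.IsSentence) (h' : ψ.IsSentence) :
    (and φ ψ).IsSentence := by
  obtain ⟨h1, h2, h3⟩ := h
  obtain ⟨h1', h2', h3'⟩ := h'
  simp [IsSentence, freeEl, freeSet, freeRel, *]

/-! ## Renaming binary symbols and collecting quantifiers -/

/-- Rename the binary symbols `B` of a formula of the two-variable fragment to `b + 4 * B`. -/
def hat (b : ℕ) : Formula → Formula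
  | bin B x y => bin (b + 4 * B) x y
  | neg φ => neg (φ.hat b)
  | and φ ψ => and (φ.hat b) (ψ.hat b)
  | ex x φ => ex x (φ.hat b)
  | exGe n x φ => exGe n x (φ.hat b)
  | φ => φ

/-- The codes `⟨n, x, φ⟩` of the subformulas `∃^{≥ n} x, φ` of the renamed formula, where `∃` is
read as `∃^{≥ 1}`. -/
def quants (b : ℕ) : Formula → List ℕ
  | neg φ => φ.quants b
  | and φ ψ => φ.quants b ++ ψ.quants b
  | ex x φ => Nat.pair 1 (Nat.pair x (φ.hat b).code) :: φ.quants b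
  | exGe n x φ => Nat.pair n (Nat.pair x (φ.hat b).code) :: φ.quants b
  | _ => []

theorem holds_hat {V : Type u} {U : ℕ → V → Prop} {R : ℕ → V → V → Prop} {b : ℕ} {φ : Formula}
    {e s r} (hφ : φ.IsC2) :
    Holds U R e s r (φ.hat b) ↔ Holds U (fun B => R (b + 4 * B)) e s r φ := by
  induction φ generalizing e with
  | neg φ ih => exact not_congr (ih hφ)
  | and φ ψ ih1 ih2 => exact and_congr (ih1 hφ.1) (ih2 hφ.2)
  | ex x φ ih => exact exists_congr fun a => ih hφ.2
  | exGe n x φ ih => simp [hat, ih hφ.2]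
  | _ => first | exact Iff.rfl | exact hφ.elim

theorem IsC2.hat {b : ℕ} {φ : Formula} (hφ : φ.IsC2) : (φ.hat b).IsC2 := by
  induction φ <;> simp_all [IsC2, Formula.hat]

theorem Over.hat {b : ℕ} {φ : Formula} {C D : Vocab} (hφ : φ.Over C) (h : φ.IsC2)
    (hun : ∀ P ∈ C.un, P ∈ D.un) (hbin : ∀ B ∈ C.bin, b + 4 * B ∈ D.bin) :
    (φ.hat b).Over D := by
  induction φ <;> simp_all [IsC2, Over, Formula.hat]

theorem IsSentence.hat {b : ℕ} {φ : Formula} (hφ : φ.IsSentence) : (φ.hat b).IsSentence := by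
  have : (φ.hat b).freeEl = φ.freeEl ∧ (φ.hat b).freeSet = φ.freeSet ∧
      (φ.hat b).freeRel = φ.freeRel := by
    clear hφ
    induction φ <;> simp_all [Formula.hat, freeEl, freeSet, freeRel]
  rwa [IsSentence, this.1, this.2.1, this.2.2]

theorem quants_spec {b : ℕ} {φ : Formula} {C D : Vocab} (hφ : φ.Over C) (h : φ.IsC2)
    (hun : ∀ P ∈ C.un, P ∈ D.un) (hbin : ∀ B ∈ C.bin, b + 4 * B ∈ D.bin) :
    ∀ q ∈ φ.quants b, q.unpair.2.unpair.1 < 2 ∧ (ofCode q.unpair.2.unpair.2).IsC2 ∧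
      (ofCode q.unpair.2.unpair.2).Over D := by
  induction φ with
  | neg φ ih => exact ih hφ h
  | and φ ψ ih1 ih2 =>
    intro q hq
    rcases List.mem_append.1 hq with hq | hq
    · exact ih1 hφ.1 h.1 q hq
    · exact ih2 hφ.2 h.2 q hq
  | ex x φ ih =>
    intro q hq
    rcases List.mem_cons.1 hq with rfl | hq
    · simpa [ofCode_code] using ⟨Nat.lt_succ_iff.1 h.1, h.2.hat, Over.hat hφ h.2 hun hbin⟩
    · exact ih hφ h.2 q hq
  | exGe n x φ ih =>
    intro q hq
    rcases List.mem_cons.1 hq with rfl | hq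
    · simpa [ofCode_code] using ⟨Nat.lt_succ_iff.1 h.1, h.2.hat, Over.hat hφ h.2 hun hbin⟩
    · exact ih hφ h.2 q hq
  | _ => intro q hq; simp [quants] at hq

end Formula

/-! ## Structures as total interpretations -/

namespace Str

variable {C : Vocab} {V : Type u}

/-- The interpretation of all unary symbols, where symbols outside `C` count as false. -/
def totUn (M : Str C V) (P : ℕ) (a : V) : Prop := ∃ h : P ∈ C.un, M.un ⟨P, h⟩ a

/-- The interpretation of all binary symbols, where symbols outside `C` count as false. -/
def totBin (M : Str C V) (B : ℕ) (a b : V) : Prop := ∃ h : B ∈ C.bin, M.bin ⟨B, h⟩ a b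

theorem sat_iff_holds (M : Str C V) {e s r} (φ : Formula) :
    M.Sat e s r φ ↔ φ.Holds M.totUn M.totBin e s r := by
  induction φ generalizing e s r with
  | neg φ ih => exact not_congr ih
  | and φ ψ ih1 ih2 => exact and_congr ih1 ih2
  | ex x φ ih => exact exists_congr fun a => ih
  | exGe n x φ ih => simp [Sat, ih]
  | exSet X φ ih => exact exists_congr fun S => ih
  | exSub Z B φ ih => exact exists_congr fun T => and_congr_right fun _ => ih
  | _ => rfl

/-- The structure given by total interpretations. -/
def ofTotal (C : Vocab) (U : ℕ → V → Prop) (R : ℕ → V → V → Prop) : Str C V :=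
  ⟨fun P => U P.1, fun B => R B.1⟩

theorem models_ofTotal {D : Vocab} {U : ℕ → V → Prop} {R : ℕ → V → V → Prop} {φ : Formula}
    (hφ : φ.Over D) (hD : D ⊆ C) :
    (ofTotal C U R).Models φ ↔ ∀ e s r, φ.Holds U R e s r := by
  refine forall₃_congr fun e s r => ?_
  rw [sat_iff_holds]
  exact Formula.holds_congr (fun P hP a => ⟨fun h => h.2, fun h => ⟨hD.1 P hP, h⟩⟩)
    (fun B hB a b => ⟨fun h => h.2, fun h => ⟨hD.2 B hB, h⟩⟩) hφ

theorem models_iff (M : Str C V) {φ : Formula} :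
    M.Models φ ↔ ∀ e s r, φ.Holds M.totUn M.totBin e s r :=
  forall₃_congr fun _ _ _ => M.sat_iff_holds φ

theorem gaifman_reduct_adj {D : Vocab} (M : Str D V) (h : C ⊆ D) (a b : V) :
    (M.reduct h).gaifman.Adj a b ↔
      a ≠ b ∧ ∃ B ∈ C.bin, M.totBin B a b ∨ M.totBin B b a := by
  rw [gaifman, SimpleGraph.fromRel_adj]
  refine and_congr_right fun _ => ?_
  constructor
  · rintro (⟨B, hB⟩ | ⟨B, hB⟩)
    · exact ⟨B.1, B.2, Or.inl ⟨_, hB⟩⟩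
    · exact ⟨B.1, B.2, Or.inr ⟨_, hB⟩⟩
  · rintro ⟨B, hB, ⟨h1, h2⟩ | ⟨h1, h2⟩⟩
    · exact Or.inl ⟨⟨B, hB⟩, h2⟩
    · exact Or.inr ⟨⟨B, hB⟩, h2⟩

end Str

theorem Vocab.subset_union_right (C D : Vocab) : D ⊆ C ∪ D :=
  ⟨fun _ h => List.mem_append_right _ h, fun _ h => List.mem_append_right _ h⟩

/-! ## The separated vocabularies and sentences -/

/-- The data on which the separated sentences depend: the vocabularies `C` and `D`, a number `base`
above all their symbols, a bound `K` on the out-degree of the graph, a number `Q` of colours, and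
the codes of the quantified subformulas of the (renamed) sentence over `D`. -/
structure SepCtx where
  base : ℕ
  K : ℕ
  Q : ℕ
  C : Vocab
  D : Vocab
  qs : List ℕ

namespace SepCtx

open Formula

variable (c : SepCtx)

/-- The number of link relations. -/
def J : ℕ := c.K + 2 * c.Q

/-- The copy of the binary symbol `B`. -/
def hatB (B : ℕ) : ℕ := c.base + 4 * B
/-- The binary symbol for the witnesses of the quantified formula with code `q`. -/
def wit (q : ℕ) : ℕ := c.base + 4 * q + 1
/-- The `j`-th link relation; `t = 2` for the version over `C'` and `t = 3` for that over `D'`. -/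
def link (t j : ℕ) : ℕ := c.base + 4 * j + t

/-- The unary symbol for the truth of the quantified formula with code `q`. -/
def truth (q : ℕ) : ℕ := c.base + 8 * q
/-- The unary symbol for the colour `q`. -/
def color (q : ℕ) : ℕ := c.base + 8 * q + 1
/-- The unary symbol for the diagonal of `E`. -/
def loop (E : ℕ) : ℕ := c.base + 8 * E + 2
/-- The unary symbol for `E(x, y)`, with `y` the `j`-th successor of `x`. -/
def fwd (j E : ℕ) : ℕ := c.base + 8 * Nat.pair j E + 3
/-- The unary symbol for `E(y, x)`, with `y` the `j`-th successor of `x`. -/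
def bwd (j E : ℕ) : ℕ := c.base + 8 * Nat.pair j E + 4
/-- The unary symbol for the domain of the `j`-th link relation. -/
def dom (j : ℕ) : ℕ := c.base + 8 * j + 5
/-- The unary symbol for `P(y)`, with `y` the `j`-th successor of `x`. -/
def succ (j P : ℕ) : ℕ := c.base + 8 * Nat.pair j P + 6

/-- The binary symbols of `D'`. -/
def binD : List ℕ :=
  (c.C.bin ++ c.D.bin).map c.hatB ++ (c.qs.map c.wit ++ (List.range c.J).map (c.link 3))

/-- The unary symbols that make up the type of an element. -/
def unType : List ℕ :=
  c.D.un ++ (c.qs.map c.truth ++ ((List.range c.Q).map c.color ++ (c.binD.map c.loop ++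
    ((List.range c.J).flatMap (fun j => c.binD.map (c.fwd j)) ++
      (List.range c.J).flatMap (fun j => c.binD.map (c.bwd j))))))

/-- All unary symbols. -/
def allUn : List ℕ :=
  -- The symbols `dom` and `succ` are shared but not part of the type: `succ` describes the type of
  -- a successor, and including it would make types refer to themselves. The unary symbols of `C`
  -- alone are not needed in the type, since `α` is never evaluated at exchanged pairs.
  c.C.un ++ (c.unType ++ ((List.range c.J).map c.dom ++
    (List.range c.J).flatMap (fun j => c.unType.map (c.succ j))))

/-- The vocabulary `C'`. -/
def C' : Vocab := ⟨c.allUn, c.C.bin ++ (List.range c.J).map (c.link 2)⟩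

/-- The vocabulary `D'`. -/
def D' : Vocab := ⟨c.allUn, c.binD⟩

/-- The properties that the links have both over `C'` and over `D'`. -/
def linkAx (t : ℕ) : Formula :=
  .and
    (allOver (List.range c.J) fun j =>
      .and (imp (bin (c.link t j) 0 1) (neg (eq 0 1)))
      (.and (iff (un (c.dom j) 0) (ex 1 (bin (c.link t j) 0 1)))
      (.and (allOver (List.range j) fun i =>
          imp (bin (c.link t j) 0 1) (neg (bin (c.link t i) 0 1)))
        (allOver c.unType fun P =>
          imp (bin (c.link t j) 0 1) (iff (un (c.succ j P) 0) (un P 1))))))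
    (allOver (List.range (2 * c.Q)) fun i =>
      imp (bin (c.link t (c.K + i)) 0 1) (bin (c.link t (c.K + i)) 1 0))

/-- The formula that `α` is extended by. -/
def alphaAx : Formula :=
  .and (c.linkAx 2)
  (.and (allOver (List.range c.J) fun j =>
      imp (.and (bin (c.link 2 j) 0 1) (bin (c.link 2 j) 0 2)) (eq 1 2))
  (.and (allOver (List.range c.K) fun j => allOver (List.range c.J) fun i =>
      imp (bin (c.link 2 j) 0 1) (neg (bin (c.link 2 i) 1 0)))
  (.and (allOver (List.range c.J) fun j => allOver c.C.bin fun B =>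
      imp (bin (c.link 2 j) 0 1)
        (.and (iff (un (c.fwd j (c.hatB B)) 0) (bin B 0 1))
          (iff (un (c.bwd j (c.hatB B)) 0) (bin B 1 0))))
  (.and (allOver c.C.bin fun B => iff (un (c.loop (c.hatB B)) 0) (bin B 0 0))
    (imp (neg (eq 0 1))
      (iff (anyOver (List.range c.J) fun j => .or (bin (c.link 2 j) 0 1) (bin (c.link 2 j) 1 0))
        (anyOver c.C.bin fun B => .or (bin B 0 1) (bin B 1 0))))))))

/-- `x` sends a message to `y`: it is linked to `y` or has `y` as a witness. -/
def msg (x y : ℕ) : Formula :=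
  .or (anyOver c.qs fun q => bin (c.wit q) x y)
    (anyOver (List.range c.J) fun j => bin (c.link 3 j) x y)

/-- The properties of the witnesses of the quantified formula with code `q`. -/
def witAx (q : ℕ) : Formula :=
  let n := q.unpair.1
  let x := q.unpair.2.unpair.1
  let φ := ofCode q.unpair.2.unpair.2
  -- With `1 - x` as the other variable, the clauses say that recorded witnesses are genuine, that
  -- all witnesses are recorded where the truth symbol fails, and that the truth symbol holds
  -- exactly where at least `n` are recorded.
  .and (imp (bin (c.wit q) (1 - x) x) φ)
  (.and (imp (.and φ (neg (un (c.truth q) (1 - x)))) (bin (c.wit q) (1 - x) x))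
    (iff (un (c.truth q) (1 - x)) (exGe n x (bin (c.wit q) (1 - x) x))))

/-- The formula that the renamed `β` is extended by. -/
def betaAx : Formula :=
  .and (c.linkAx 3)
  (.and (allOver (List.range c.J) fun j => atMostOne 1 (bin (c.link 3 j) 0 1))
  (.and (allOver (List.range c.K) fun j => imp (bin (c.link 3 j) 0 1) (neg (c.msg 1 0)))
  (.and (allOver (List.range c.J) fun j => allOver c.binD fun E =>
      imp (bin (c.link 3 j) 0 1)
        (.and (iff (un (c.fwd j E) 0) (bin E 0 1)) (iff (un (c.bwd j E) 0) (bin E 1 0))))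
  (.and (allOver c.binD fun E => iff (un (c.loop E) 0) (bin E 0 0))
  (.and (allOver c.C.bin fun B => imp (bin (c.hatB B) 0 1)
      (.or (eq 0 1)
        (anyOver (List.range c.J) fun j => .or (bin (c.link 3 j) 0 1) (bin (c.link 3 j) 1 0))))
  (.and (anyOver (List.range c.Q) fun q => un (c.color q) 0)
  -- A path of length two involves three elements, but only two variables are available. Counting
  -- around the middle element helps: if it has both a sender and a receiver of colour `q`, then it
  -- has only one neighbour of that colour.
  (.and (allOver (List.range c.Q) fun q =>
      imp (.and (ex 1 (.and (c.msg 1 0) (un (c.color q) 1)))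
          (ex 1 (.and (c.msg 0 1) (un (c.color q) 1))))
        (atMostOne 1 (.and (.or (c.msg 1 0) (c.msg 0 1)) (un (c.color q) 1))))
    (allOver c.qs c.witAx))))))))

/-- The sentence `α'`. -/
def alpha' (α : Formula) : Formula := .and α (all 0 (all 1 (all 2 c.alphaAx)))

/-- The sentence `β'`. -/
def beta' (β : Formula) : Formula := .and (β.hat c.base) (all 0 (all 1 c.betaAx))

/-! ### Syntactic properties -/

variable {c}

theorem mem_binD {E : ℕ} : E ∈ c.binD ↔ (∃ B, (B ∈ c.C.bin ∨ B ∈ c.D.bin) ∧ c.hatB B = E) ∨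
    (∃ q ∈ c.qs, c.wit q = E) ∨ ∃ j < c.J, c.link 3 j = E := by
  simp [binD, or_and_right, exists_or, or_assoc]

theorem mem_unType {P : ℕ} : P ∈ c.unType ↔ P ∈ c.D.un ∨ (∃ q ∈ c.qs, c.truth q = P) ∨
    (∃ q < c.Q, c.color q = P) ∨ (∃ E ∈ c.binD, c.loop E = P) ∨
    (∃ j < c.J, ∃ E ∈ c.binD, c.fwd j E = P) ∨ ∃ j < c.J, ∃ E ∈ c.binD, c.bwd j E = P := by
  simp [unType]

theorem mem_allUn {P : ℕ} : P ∈ c.allUn ↔ P ∈ c.C.un ∨ P ∈ c.unType ∨ (∃ j < c.J, c.dom j = P) ∨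
    ∃ j < c.J, ∃ P' ∈ c.unType, c.succ j P' = P := by
  simp [allUn]

theorem mem_allUn_of_mem_unType {P : ℕ} (h : P ∈ c.unType) : P ∈ c.allUn := mem_allUn.2 (Or.inr (Or.inl h))

theorem hatB_mem_left {B : ℕ} (h : B ∈ c.C.bin) : c.hatB B ∈ c.binD :=
  mem_binD.2 (Or.inl ⟨B, Or.inl h, rfl⟩)
theorem hatB_mem_right {B : ℕ} (h : B ∈ c.D.bin) : c.hatB B ∈ c.binD :=
  mem_binD.2 (Or.inl ⟨B, Or.inr h, rfl⟩)
theorem wit_mem {q : ℕ} (h : q ∈ c.qs) : c.wit q ∈ c.binD :=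
  mem_binD.2 (Or.inr (Or.inl ⟨q, h, rfl⟩))
theorem link_mem {j : ℕ} (h : j < c.J) : c.link 3 j ∈ c.binD :=
  mem_binD.2 (Or.inr (Or.inr ⟨j, h, rfl⟩))

theorem un_mem {P : ℕ} (h : P ∈ c.D.un) : P ∈ c.unType := mem_unType.2 (Or.inl h)
theorem truth_mem {q : ℕ} (h : q ∈ c.qs) : c.truth q ∈ c.unType :=
  mem_unType.2 (Or.inr (Or.inl ⟨q, h, rfl⟩))
theorem color_mem {q : ℕ} (h : q < c.Q) : c.color q ∈ c.unType :=
  mem_unType.2 (Or.inr (Or.inr (Or.inl ⟨q, h, rfl⟩)))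
theorem loop_mem {E : ℕ} (h : E ∈ c.binD) : c.loop E ∈ c.unType :=
  mem_unType.2 (Or.inr (Or.inr (Or.inr (Or.inl ⟨E, h, rfl⟩))))
theorem fwd_mem {j E : ℕ} (hj : j < c.J) (h : E ∈ c.binD) : c.fwd j E ∈ c.unType :=
  mem_unType.2 (Or.inr (Or.inr (Or.inr (Or.inr (Or.inl ⟨j, hj, E, h, rfl⟩)))))
theorem bwd_mem {j E : ℕ} (hj : j < c.J) (h : E ∈ c.binD) : c.bwd j E ∈ c.unType :=
  mem_unType.2 (Or.inr (Or.inr (Or.inr (Or.inr (Or.inr ⟨j, hj, E, h, rfl⟩)))))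
theorem dom_mem {j : ℕ} (hj : j < c.J) : c.dom j ∈ c.allUn :=
  mem_allUn.2 (Or.inr (Or.inr (Or.inl ⟨j, hj, rfl⟩)))
theorem succ_mem {j P : ℕ} (hj : j < c.J) (h : P ∈ c.unType) : c.succ j P ∈ c.allUn :=
  mem_allUn.2 (Or.inr (Or.inr (Or.inr ⟨j, hj, P, h, rfl⟩)))

theorem lt_J_of_lt_K {j : ℕ} (h : j < c.K) : j < c.J := by unfold J; omega
theorem add_lt_J {i : ℕ} (h : i < 2 * c.Q) : c.K + i < c.J := by unfold J; omega

theorem linkAx_over {t : ℕ} {E : Vocab} (hun : E.un = c.allUn)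
    (hbin : ∀ j < c.J, c.link t j ∈ E.bin) : (c.linkAx t).Over E := by
  simp only [linkAx, Over, allOver_over, imp_over, iff_over, List.mem_range, hun,
    and_true]
  exact ⟨fun j hj => ⟨hbin j hj, ⟨dom_mem hj, hbin j hj⟩,
    fun i hi => ⟨hbin j hj, hbin i (hi.trans hj)⟩,
    fun P hP => ⟨hbin j hj, succ_mem hj hP, mem_allUn_of_mem_unType hP⟩⟩,
    fun i hi => ⟨hbin _ (add_lt_J hi), hbin _ (add_lt_J hi)⟩⟩

theorem alphaAx_over : c.alphaAx.Over c.C' := by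
  have hB : ∀ B ∈ c.C.bin, B ∈ c.C'.bin := fun B h => List.mem_append_left _ h
  have hl : ∀ j < c.J, c.link 2 j ∈ c.C'.bin := fun j h =>
    List.mem_append_right _ (List.mem_map_of_mem (List.mem_range.2 h))
  have hu : ∀ P ∈ c.unType, P ∈ c.C'.un := fun P hP => mem_allUn_of_mem_unType hP
  simp only [alphaAx, Over, allOver_over, anyOver_over, or_over, imp_over, iff_over,
    List.mem_range, true_and, and_true]
  exact ⟨linkAx_over rfl hl, fun j hj => ⟨hl j hj, hl j hj⟩,
    fun j hj i hi => ⟨hl j (lt_J_of_lt_K hj), hl i hi⟩,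
    fun j hj B h => ⟨hl j hj, ⟨hu _ (fwd_mem hj (hatB_mem_left h)), hB B h⟩,
      hu _ (bwd_mem hj (hatB_mem_left h)), hB B h⟩,
    fun B h => ⟨hu _ (loop_mem (hatB_mem_left h)), hB B h⟩,
    fun j hj => ⟨hl j hj, hl j hj⟩, fun B h => ⟨hB B h, hB B h⟩⟩

theorem alphaAx_isMSO : c.alphaAx.IsMSO := by
  simp [alphaAx, linkAx, IsMSO, allOver_isMSO, anyOver_isMSO, or_isMSO, imp_isMSO, iff_isMSO]

theorem alphaAx_elementsLT : c.alphaAx.ElementsLT 3 := by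
  simp [alphaAx, linkAx, ElementsLT, allOver_elementsLT, anyOver_elementsLT, or_elementsLT,
    imp_elementsLT, iff_elementsLT]

theorem alpha'_mem {α : Formula} (hα : α ∈ MSO c.C) : c.alpha' α ∈ MSO c.C' := by
  refine ⟨⟨hα.1, alphaAx_isMSO⟩, ⟨?_, alphaAx_over⟩, hα.2.2.and alphaAx_elementsLT.isSentence_all₃⟩
  have := hα.2.1
  clear hα
  induction α with
  | un P x => exact mem_allUn.2 (Or.inl this)
  | bin B x y => exact List.mem_append_left _ this
  | neg φ ih => exact ih this
  | and φ ψ ih1 ih2 => exact ⟨ih1 this.1, ih2 this.2⟩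
  | ex x φ ih => exact ih this
  | exGe n x φ ih => exact ih this
  | exSet X φ ih => exact ih this
  | exSub Z B φ ih => exact ⟨List.mem_append_left _ this.1, ih this.2⟩
  | _ => trivial

theorem msg_over {x y : ℕ} : (c.msg x y).Over c.D' := by
  simp only [msg, or_over, anyOver_over, Over, List.mem_range]
  exact ⟨fun q hq => wit_mem hq, fun j hj => link_mem hj⟩

theorem msg_isC2 {x y : ℕ} (hx : x < 2) (hy : y < 2) : (c.msg x y).IsC2 := by
  simp [msg, or_isC2, anyOver_isC2, IsC2, hx, hy]

theorem betaAx_over (h : ∀ q ∈ c.qs, (ofCode q.unpair.2.unpair.2).Over c.D') :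
    c.betaAx.Over c.D' := by
  have hu : ∀ P ∈ c.unType, P ∈ c.D'.un := fun P hP => mem_allUn_of_mem_unType hP
  have hl : ∀ j < c.J, c.link 3 j ∈ c.D'.bin := fun j => link_mem
  simp only [betaAx, witAx, Over, allOver_over, anyOver_over, or_over, imp_over, iff_over,
    atMostOne_over, List.mem_range, true_and]
  exact ⟨linkAx_over rfl hl, hl, fun j hj => ⟨hl j (lt_J_of_lt_K hj), msg_over⟩,
    fun j hj E h => ⟨hl j hj, ⟨hu _ (fwd_mem hj h), h⟩, hu _ (bwd_mem hj h), h⟩,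
    fun E h => ⟨hu _ (loop_mem h), h⟩,
    fun B h => ⟨hatB_mem_left h, fun j hj => ⟨hl j hj, hl j hj⟩⟩,
    fun q hq => hu _ (color_mem hq),
    fun q hq => ⟨⟨⟨msg_over, hu _ (color_mem hq)⟩, msg_over, hu _ (color_mem hq)⟩,
      ⟨msg_over, msg_over⟩, hu _ (color_mem hq)⟩,
    fun q hq => ⟨⟨wit_mem hq, h q hq⟩, ⟨⟨h q hq, hu _ (truth_mem hq)⟩, wit_mem hq⟩,
      hu _ (truth_mem hq), wit_mem hq⟩⟩

theorem betaAx_isC2 (h : ∀ q ∈ c.qs, q.unpair.2.unpair.1 < 2 ∧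
    (ofCode q.unpair.2.unpair.2).IsC2) : c.betaAx.IsC2 := by
  simp only [betaAx, linkAx, witAx, IsC2, allOver_isC2, anyOver_isC2, or_isC2, imp_isC2, iff_isC2,
    atMostOne_isC2, msg_isC2, Nat.one_lt_ofNat, Nat.ofNat_pos, and_self, implies_true, true_and]
  intro q hq
  have h1 : 1 - q.unpair.2.unpair.1 < 2 := by omega
  exact ⟨⟨⟨h1, (h q hq).1⟩, (h q hq).2⟩, ⟨⟨(h q hq).2, h1⟩, h1, (h q hq).1⟩, h1, (h q hq).1,
    h1, (h q hq).1⟩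

theorem qs_spec {β : Formula} (hβ : β ∈ C2 c.D) (hqs : c.qs = β.quants c.base) :
    ∀ q ∈ c.qs, q.unpair.2.unpair.1 < 2 ∧ (ofCode q.unpair.2.unpair.2).IsC2 ∧
      (ofCode q.unpair.2.unpair.2).Over c.D' := by
  rw [hqs]
  exact quants_spec hβ.2.1 hβ.1 (fun P hP => mem_allUn_of_mem_unType (un_mem hP))
    (fun B hB => hatB_mem_right hB)

theorem beta'_mem {β : Formula} (hβ : β ∈ C2 c.D) (hqs : c.qs = β.quants c.base) :
    c.beta' β ∈ C2 c.D' := by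
  have h := qs_spec hβ hqs
  have h2 := betaAx_isC2 fun q hq => ⟨(h q hq).1, (h q hq).2.1⟩
  refine ⟨⟨hβ.1.hat, by simp, by simp, h2⟩,
    ⟨Over.hat hβ.2.1 hβ.1 (fun P hP => mem_allUn_of_mem_unType (un_mem hP))
      (fun B hB => hatB_mem_right hB), betaAx_over fun q hq => (h q hq).2.2⟩,
    hβ.2.2.hat.and h2.elementsLT.isSentence_all₂⟩

theorem shareOnlyUnary (hb : ∀ B ∈ c.C.bin, B < c.base) : c.C'.ShareOnlyUnary c.D' := by
  intro B hB hB'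
  have h1 : B < c.base ∨ ∃ j, c.base + 4 * j + 2 = B := by
    rcases List.mem_append.1 hB with h | h
    · exact Or.inl (hb B h)
    · obtain ⟨j, -, rfl⟩ := List.mem_map.1 h
      exact Or.inr ⟨j, rfl⟩
  rcases mem_binD.1 hB' with ⟨B', -, rfl⟩ | ⟨q, -, rfl⟩ | ⟨j, -, rfl⟩ <;>
    simp only [hatB, wit, link] at h1 <;>
    rcases h1 with h1 | ⟨i, h1⟩ <;> omega

end SepCtx

/-! ## The meaning of the added axioms -/

namespace SepCtx

open Formula

variable (c : SepCtx) {V : Type u} (U : ℕ → V → Prop) (R : ℕ → V → V → Prop)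

/-- The meaning of `linkAx`. -/
structure LinkSpec (t : ℕ) : Prop where
  irrefl : ∀ j < c.J, ∀ a b, R (c.link t j) a b → a ≠ b
  dom : ∀ j < c.J, ∀ a, U (c.dom j) a ↔ ∃ b, R (c.link t j) a b
  disjoint : ∀ j < c.J, ∀ i < j, ∀ a b, R (c.link t j) a b → ¬ R (c.link t i) a b
  succ : ∀ j < c.J, ∀ P ∈ c.unType, ∀ a b, R (c.link t j) a b → (U (c.succ j P) a ↔ U P b)
  symm : ∀ i < 2 * c.Q, ∀ a b, R (c.link t (c.K + i)) a b → R (c.link t (c.K + i)) b a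

/-- The meaning of `alphaAx`. -/
structure AlphaSpec : Prop extends LinkSpec c U R 2 where
  func : ∀ j < c.J, ∀ a b b', R (c.link 2 j) a b → R (c.link 2 j) a b' → b = b'
  directed : ∀ j < c.K, ∀ i < c.J, ∀ a b, R (c.link 2 j) a b → ¬ R (c.link 2 i) b a
  fwd : ∀ j < c.J, ∀ B ∈ c.C.bin, ∀ a b, R (c.link 2 j) a b → (U (c.fwd j (c.hatB B)) a ↔ R B a b)
  bwd : ∀ j < c.J, ∀ B ∈ c.C.bin, ∀ a b, R (c.link 2 j) a b → (U (c.bwd j (c.hatB B)) a ↔ R B b a)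
  loop : ∀ B ∈ c.C.bin, ∀ a, U (c.loop (c.hatB B)) a ↔ R B a a
  edge : ∀ a b, a ≠ b → ((∃ j < c.J, R (c.link 2 j) a b ∨ R (c.link 2 j) b a) ↔
    ∃ B ∈ c.C.bin, R B a b ∨ R B b a)

/-- The meaning of `msg`. -/
def Msg (a b : V) : Prop := (∃ q ∈ c.qs, R (c.wit q) a b) ∨ ∃ j < c.J, R (c.link 3 j) a b

/-- The meaning of `betaAx`. -/
structure BetaSpec : Prop extends LinkSpec c U R 3 where
  func : ∀ j < c.J, ∀ a b b', R (c.link 3 j) a b → R (c.link 3 j) a b' → b = b'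
  directed : ∀ j < c.K, ∀ a b, R (c.link 3 j) a b → ¬ c.Msg R b a
  fwd : ∀ j < c.J, ∀ E ∈ c.binD, ∀ a b, R (c.link 3 j) a b → (U (c.fwd j E) a ↔ R E a b)
  bwd : ∀ j < c.J, ∀ E ∈ c.binD, ∀ a b, R (c.link 3 j) a b → (U (c.bwd j E) a ↔ R E b a)
  loop : ∀ E ∈ c.binD, ∀ a, U (c.loop E) a ↔ R E a a
  edge : ∀ B ∈ c.C.bin, ∀ a b, R (c.hatB B) a b →
    a = b ∨ ∃ j < c.J, R (c.link 3 j) a b ∨ R (c.link 3 j) b a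
  colored : ∀ a, ∃ q < c.Q, U (c.color q) a
  coloring : ∀ q < c.Q, ∀ a b b', c.Msg R b a → c.Msg R a b' → U (c.color q) b →
    U (c.color q) b' → b = b'
  wit : ∀ q ∈ c.qs, ∀ e s r, Holds U R e s r (c.witAx q)

variable {c U R}

theorem forall_holds_linkAx [Nonempty V] {t : ℕ} :
    (∀ e s r, Holds U R e s r (c.linkAx t)) ↔ LinkSpec c U R t := by
  constructor
  · intro h
    have h' : ∀ a b : V, _ := fun a b =>
      h (fun v => if v = 0 then a else b) (fun _ => ∅) fun _ _ _ => False
    simp only [linkAx, holds_and, holds_allOver, holds_imp, holds_iff, holds_bin, holds_un,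
      holds_neg, holds_eq, holds_ex, List.mem_range, if_true, one_ne_zero, if_false,
      Function.update_self, ne_eq, zero_ne_one, not_false_eq_true, Function.update_of_ne] at h'
    exact ⟨fun j hj a b => ((h' a b).1 j hj).1, fun j hj a => ((h' a a).1 j hj).2.1,
      fun j hj i hi a b => ((h' a b).1 j hj).2.2.1 i hi,
      fun j hj P hP a b => ((h' a b).1 j hj).2.2.2 P hP, fun i hi a b => (h' a b).2 i hi⟩
  · intro h e s r
    simp only [linkAx, holds_and, holds_allOver, holds_imp, holds_iff, holds_bin, holds_un,
      holds_neg, holds_eq, holds_ex, List.mem_range,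
      Function.update_self, ne_eq, zero_ne_one, not_false_eq_true, Function.update_of_ne]
    exact ⟨fun j hj => ⟨h.irrefl j hj _ _, h.dom j hj _, fun i hi => h.disjoint j hj i hi _ _,
      fun P hP => h.succ j hj P hP _ _⟩, fun i hi => h.symm i hi _ _⟩

theorem forall_holds_alphaAx [Nonempty V] :
    (∀ e s r, Holds U R e s r c.alphaAx) ↔ AlphaSpec c U R := by
  constructor
  · intro h
    have hl : LinkSpec c U R 2 := forall_holds_linkAx.1 fun e s r => (h e s r).1
    have h' : ∀ a b b' : V, _ := fun a b b' =>
      (h (fun v => if v = 0 then a else if v = 1 then b else b') (fun _ => ∅)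
        fun _ _ _ => False).2
    simp only [holds_and, holds_allOver, holds_imp, holds_iff, holds_bin, holds_un,
      holds_neg, holds_eq, holds_anyOver, holds_or, List.mem_range, if_true, one_ne_zero, if_false,
      OfNat.ofNat_ne_zero, OfNat.ofNat_ne_one] at h'
    exact
      { hl with
        func := fun j hj a b b' h1 h2 => (h' a b b').1 j hj ⟨h1, h2⟩
        directed := fun j hj i hi a b => (h' a b b).2.1 j hj i hi
        fwd := fun j hj B hB a b h1 => ((h' a b b).2.2.1 j hj B hB h1).1
        bwd := fun j hj B hB a b h1 => ((h' a b b).2.2.1 j hj B hB h1).2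
        loop := fun B hB a => (h' a a a).2.2.2.1 B hB
        edge := fun a b hab => (h' a b b).2.2.2.2 hab }
  · intro h e s r
    refine ⟨forall_holds_linkAx.2 h.toLinkSpec e s r, ?_⟩
    simp only [holds_and, holds_allOver, holds_imp, holds_iff, holds_bin, holds_un,
      holds_neg, holds_eq, holds_anyOver, holds_or, List.mem_range]
    exact ⟨fun j hj h1 => h.func j hj _ _ _ h1.1 h1.2, fun j hj i hi => h.directed j hj i hi _ _,
      fun j hj B hB h1 => ⟨h.fwd j hj B hB _ _ h1, h.bwd j hj B hB _ _ h1⟩,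
      fun B hB => h.loop B hB _, fun h1 => h.edge _ _ h1⟩

theorem holds_msg {e s r} {x y : ℕ} : Holds U R e s r (c.msg x y) ↔ c.Msg R (e x) (e y) := by
  simp [msg, Msg]

theorem forall_holds_betaAx [Nonempty V] :
    (∀ e s r, Holds U R e s r c.betaAx) ↔ BetaSpec c U R := by
  constructor
  · intro h
    have hl : LinkSpec c U R 3 := forall_holds_linkAx.1 fun e s r => (h e s r).1
    have h' : ∀ a b : V, _ := fun a b =>
      (h (fun v => if v = 0 then a else b) (fun _ => ∅) fun _ _ _ => False).2
    simp only [holds_and, holds_allOver, holds_imp, holds_iff, holds_bin, holds_un, holds_ex,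
      holds_neg, holds_eq, holds_anyOver, holds_or, List.mem_range, if_true, one_ne_zero, if_false,
      holds_atMostOne, holds_msg, Function.update_self, ne_eq, zero_ne_one, not_false_eq_true,
      Function.update_of_ne] at h'
    exact
      { hl with
        func := fun j hj a b b' h1 h2 => (h' a b).1 j hj b b' h1 h2
        directed := fun j hj a b => (h' a b).2.1 j hj
        fwd := fun j hj B hB a b h1 => ((h' a b).2.2.1 j hj B hB h1).1
        bwd := fun j hj B hB a b h1 => ((h' a b).2.2.1 j hj B hB h1).2
        loop := fun B hB a => (h' a a).2.2.2.1 B hB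
        edge := fun B hB a b h1 => (h' a b).2.2.2.2.1 B hB h1
        colored := fun a => (h' a a).2.2.2.2.2.1
        coloring := fun q hq a b b' h1 h2 h3 h4 => (h' a a).2.2.2.2.2.2.1 q hq
          ⟨⟨b, h1, h3⟩, b', h2, h4⟩ b b' ⟨Or.inl h1, h3⟩ ⟨Or.inr h2, h4⟩
        wit := fun q hq e s r => holds_allOver.1 (h e s r).2.2.2.2.2.2.2.2 q hq }
  · intro h e s r
    refine ⟨forall_holds_linkAx.2 h.toLinkSpec e s r, ?_⟩
    simp only [holds_and, holds_allOver, holds_imp, holds_iff, holds_bin, holds_un, holds_ex,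
      holds_neg, holds_eq, holds_anyOver, holds_or, List.mem_range,
      holds_atMostOne, holds_msg, Function.update_self, ne_eq, zero_ne_one, not_false_eq_true,
      Function.update_of_ne]
    refine ⟨fun j hj b b' => h.func j hj _ b b', fun j hj => h.directed j hj _ _,
      fun j hj E hE h1 => ⟨h.fwd j hj E hE _ _ h1, h.bwd j hj E hE _ _ h1⟩,
      fun E hE => h.loop E hE _, fun B hB h1 => h.edge B hB _ _ h1, h.colored _, ?_,
      fun q hq => h.wit q hq e s r⟩
    rintro q hq ⟨⟨b, h1, h3⟩, b', h2, h4⟩ x y hx hy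
    obtain rfl := h.coloring q hq _ _ _ h1 h2 h3 h4
    -- As `b` both sends to and receives from `e 0`, any other neighbour of its colour forms a path
    -- of length two with it.
    have hb : ∀ x, (c.Msg R x (e 0) ∨ c.Msg R (e 0) x) ∧ U (c.color q) x → x = b := by
      rintro x ⟨hx | hx, hqx⟩
      · exact h.coloring q hq _ _ _ hx h2 hqx h3
      · exact (h.coloring q hq _ _ _ h1 hx h3 hqx).symm
    exact (hb x hx).trans (hb y hy).symm

/-! ## From models of the separated sentences to models of the original ones -/

/-- Recorded witnesses decide the quantifier: if `T` holds they already number `n`, and otherwise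
they are all the witnesses. -/
theorem le_encard_iff_of_witnesses {n : ℕ} {T : Prop} {W S : Set V} (h1 : W ⊆ S)
    (h2 : ¬ T → S ⊆ W) (h3 : T ↔ (n : ℕ∞) ≤ W.encard) : (n : ℕ∞) ≤ S.encard ↔ T := by
  constructor
  · intro h
    by_contra hT
    exact hT (h3.2 (h.trans (Set.encard_le_encard (h2 hT))))
  · intro hT
    exact (h3.1 hT).trans (Set.encard_le_encard h1)

/-- Let `R'` arise from `R` by replacing each pair `(a, b)` of elements by an equivalent pair
`(s a b, s b a)`.  If this preserves the numbers of witnesses, then it preserves the truth of the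
formulas of the two-variable fragment all of whose quantified subformulas have witnesses. -/
theorem holds_iff_holds_hat {R' : ℕ → V → V → Prop} {s : V → V → V}
    (hs : ∀ a b, s a b = s b a ↔ a = b) (hU : ∀ P ∈ c.unType, ∀ a b, U P (s a b) ↔ U P a)
    (hR : ∀ B ∈ c.D.bin, ∀ a b, R' B a b ↔ R (c.hatB B) (s a b) (s b a))
    (hloop : ∀ B ∈ c.D.bin, ∀ a, U (c.loop (c.hatB B)) a ↔ R (c.hatB B) a a)
    (hwit : ∀ q ∈ c.qs, ∀ a (n : ℕ),
      (n : ℕ∞) ≤ {b | R (c.wit q) (s a b) (s b a)}.encard ↔ (n : ℕ∞) ≤ {b | R (c.wit q) a b}.encard)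
    (hax : ∀ q ∈ c.qs, ∀ e s r, Holds U R e s r (c.witAx q))
    {S : ℕ → Set V} {Z : ℕ → V → V → Prop} {φ : Formula} (hφ : φ.IsC2) (hD : φ.Over c.D)
    (hq : ∀ q ∈ φ.quants c.base, q ∈ c.qs) {e e' : ℕ → V} (h0 : e' 0 = s (e 0) (e 1))
    (h1 : e' 1 = s (e 1) (e 0)) :
    Holds U R' e S Z φ ↔ Holds U R e' S Z (φ.hat c.base) := by
  -- Both quantified formulas are equivalent to the truth symbol at the element that is not
  -- quantified. This symbol is part of the type, so the exchange of pairs does not change it.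
  have hquant : ∀ {n x : ℕ} {φ : Formula}, Nat.pair n (Nat.pair x (φ.hat c.base).code) ∈ c.qs →
      x < 2 → (∀ {e e' : ℕ → V}, e' 0 = s (e 0) (e 1) → e' 1 = s (e 1) (e 0) →
        (Holds U R' e S Z φ ↔ Holds U R e' S Z (φ.hat c.base))) →
      ∀ {e e' : ℕ → V}, e' 0 = s (e 0) (e 1) → e' 1 = s (e 1) (e 0) →
      (Holds U R' e S Z (exGe n x φ) ↔ Holds U R e' S Z (exGe n x (φ.hat c.base))) := by
    intro n x φ hmem hx ih e e' h0 h1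
    set q := Nat.pair n (Nat.pair x (φ.hat c.base).code) with hqdef
    have hax' := hax q hmem
    have hne : 1 - x ≠ x := by omega
    simp only [witAx, hqdef, Nat.unpair_pair, ofCode_code, holds_and, holds_imp, holds_iff,
      holds_neg, holds_un, holds_bin, holds_exGe, Function.update_self,
      Function.update_of_ne hne] at hax'
    rw [← hqdef] at hax'
    have hT : U (c.truth q) (e' (1 - x)) ↔ U (c.truth q) (e (1 - x)) := by
      interval_cases x
      · rw [h1]; exact hU _ (truth_mem hmem) _ _
      · rw [h0]; exact hU _ (truth_mem hmem) _ _
    rw [holds_exGe, holds_exGe]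
    refine Iff.trans (b := U (c.truth q) (e (1 - x))) ?_ (hT.symm.trans
      (le_encard_iff_of_witnesses (W := {b | R (c.wit q) (e' (1 - x)) b}) ?_ ?_
        (hax' e' S Z).2.2).symm)
    -- Each choice of `b` forms a new pair with `e (1 - x)`, and the renamed formula is evaluated at
    -- the pair replacing that one.
    · have key : ∀ b, ∃ e'' : ℕ → V, e'' (1 - x) = s (e (1 - x)) b ∧ e'' x = s b (e (1 - x)) ∧
          (Holds U R' (Function.update e x b) S Z φ ↔ Holds U R e'' S Z (φ.hat c.base)) := by
        intro b
        refine ⟨Function.update (fun _ => s (e (1 - x)) b) x (s b (e (1 - x))),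
          Function.update_of_ne hne _ _, Function.update_self _ _ _, ih ?_ ?_⟩ <;>
        · interval_cases x <;> simp
      refine le_encard_iff_of_witnesses
        (W := {b | R (c.wit q) (s (e (1 - x)) b) (s b (e (1 - x)))}) ?_ ?_
        (((hax' e S Z).2.2).trans (hwit q hmem _ n).symm)
      · intro b hb
        obtain ⟨e'', he1, he2, he⟩ := key b
        refine he.2 ((hax' e'' S Z).1 ?_)
        rw [he1, he2]; exact hb
      · intro hn b hb
        obtain ⟨e'', he1, he2, he⟩ := key b
        have := (hax' e'' S Z).2.1 ⟨he.1 hb, by rwa [he1, hU _ (truth_mem hmem)]⟩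
        rwa [he1, he2] at this
    · intro b hb
      refine (hax' _ S Z).1 ?_
      rw [Function.update_self, Function.update_of_ne hne]
      exact hb
    · intro hn b hb
      have := (hax' _ S Z).2.1 ⟨hb, by rwa [Function.update_of_ne hne]⟩
      rwa [Function.update_self, Function.update_of_ne hne] at this
  induction φ generalizing e e' with
  | eq x y =>
    obtain ⟨hx, hy⟩ := hφ
    interval_cases x <;> interval_cases y <;>
      simp [hat, h0, h1, hs, eq_comm]
  | un P x =>
    have hP := hU P (un_mem hD)
    have hx : x < 2 := hφ
    interval_cases x <;> simp [hat, h0, h1, hP]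
  | bin B x y =>
    obtain ⟨hx, hy⟩ := hφ
    -- Diagonal values are recorded in the type by `loop`, hence are insensitive to replacing `a` by
    -- `s a b`.
    have hdiag : ∀ a b, R' B a a ↔ R (c.hatB B) (s a b) (s a b) := by
      intro a b
      have hl := hU _ (loop_mem (hatB_mem_right hD))
      rw [hR B hD, ← hloop B hD, ← hloop B hD, hl, hl]
    change _ ↔ R (c.hatB B) _ _
    interval_cases x <;> interval_cases y <;> rw [holds_bin]
    · rw [h0]; exact hdiag _ _
    · rw [h0, h1]; exact hR B hD _ _
    · rw [h0, h1]; exact hR B hD _ _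
    · rw [h1]; exact hdiag _ _
  | mem X x => exact hφ.elim
  | mem₂ Z x y => exact hφ.elim
  | neg φ ih => exact not_congr (ih hφ hD hq h0 h1)
  | and φ ψ ih1 ih2 =>
    exact and_congr (ih1 hφ.1 hD.1 (fun q h => hq q (List.mem_append_left _ h)) h0 h1)
      (ih2 hφ.2 hD.2 (fun q h => hq q (List.mem_append_right _ h)) h0 h1)
  | ex x φ ih =>
    have := hquant (hq _ List.mem_cons_self) hφ.1
      (ih hφ.2 hD fun q h => hq q (List.mem_cons_of_mem _ h)) h0 h1
    rw [holds_exGe, holds_exGe, Nat.cast_one, Set.one_le_encard_iff_nonempty,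
      Set.one_le_encard_iff_nonempty] at this
    exact this
  | exGe n x φ ih =>
    exact hquant (hq _ List.mem_cons_self) hφ.1
      (ih hφ.2 hD fun q h => hq q (List.mem_cons_of_mem _ h)) h0 h1
  | exSet X φ ih => exact hφ.elim
  | exSub Z B φ ih => exact hφ.elim

/-- The rewiring of an interpretation that satisfies the added axioms. -/
theorem exists_rewired [Finite V] (hA : AlphaSpec c U R) (hB : BetaSpec c U R) :
    ∃ s : V → V → V, (∀ a b, s a b = s b a ↔ a = b) ∧
      (∀ P ∈ c.unType, ∀ a b, U P (s a b) ↔ U P a) ∧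
      (∀ q ∈ c.qs, ∀ a (n : ℕ), (n : ℕ∞) ≤ {b | R (c.wit q) (s a b) (s b a)}.encard ↔
        (n : ℕ∞) ≤ {b | R (c.wit q) a b}.encard) ∧
      ∀ B ∈ c.C.bin, ∀ a b, R (c.hatB B) (s a b) (s b a) ↔ R B a b := by
  let r : Setoid V := ⟨fun a b => ∀ P ∈ c.unType, U P a ↔ U P b, fun a P _ => Iff.rfl,
    fun h P hP => (h P hP).symm, fun h h' P hP => (h P hP).trans (h' P hP)⟩
  have symm : ∀ t, LinkSpec c U R t → ∀ j < c.J, c.K ≤ j → ∀ a b, R (c.link t j) a b →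
      R (c.link t j) b a := by
    intro t ht j hj hKj a b
    obtain ⟨i, rfl⟩ := Nat.exists_eq_add_of_le hKj
    exact ht.symm i (by unfold J at hj; omega) a b
  obtain ⟨s, σ, hsr, hs, hσ, hE⟩ := exists_rewiring r c.J (fun j => c.K ≤ j)
    (fun j => R (c.link 2 j)) (fun j => R (c.link 3 j)) (c.Msg R) hA.func hB.func hA.irrefl
    hB.irrefl hA.disjoint hB.disjoint
    (fun j hj a => (hA.dom j hj a).symm.trans (hB.dom j hj a))
    (fun j hj a b b' h h' P hP => (hB.succ j hj P hP a b' h').symm.trans (hA.succ j hj P hP a b h))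
    (symm 2 hA.toLinkSpec) (symm 3 hB.toLinkSpec)
    (fun j hj hjK i hi => hA.directed j (not_le.1 hjK) i hi)
    (fun j hj hjK => hB.directed j (not_le.1 hjK))
    (fun j hj a b h => Or.inr ⟨j, hj, h⟩)
    (fun a b b' h h' hr => by
      obtain ⟨q, hq, hqb⟩ := hB.colored b
      exact hB.coloring q hq a b b' h h' hqb ((hr _ (color_mem hq)).1 hqb))
  -- Along a link, `E` is determined by the type of the first element, through `fwd`; this is the
  -- invariance that the rewiring requires on symmetric links.
  have hmsg : ∀ E ∈ c.binD, (∀ x y, R E x y → c.Msg R x y) →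
      ∀ x y, R E (s x y) (s y x) ↔ R E x (σ x y) := fun E hE' h =>
    hE (R E) h fun j hj _ x y x' y' h1 h2 hxx' => by
      rw [← hB.fwd j hj E hE' x y h1, ← hB.fwd j hj E hE' x' y' h2]
      exact hxx' _ (fwd_mem hj hE')
  have hlink : ∀ j < c.J, ∀ x y, R (c.link 3 j) (s x y) (s y x) ↔ R (c.link 2 j) x y :=
    fun j hj x y => (hmsg _ (link_mem hj) (fun x y h => Or.inr ⟨j, hj, h⟩) x y).trans (hσ j hj x y)
  refine ⟨s, hs, fun P hP a b => hsr a b P hP, fun q hq a n => ?_, fun B hBC a b => ?_⟩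
  · have h1 := hmsg _ (wit_mem hq) (fun x y h => Or.inl ⟨q, hq, h⟩)
    have h2 : {b | R (c.wit q) (s a b) (s b a)} = σ a ⁻¹' {b | R (c.wit q) a b} :=
      Set.ext fun b => h1 a b
    rw [h2, Set.encard_preimage_of_bijective (σ a).bijective]
  · have hE' := hatB_mem_left hBC
    have hedge : ∀ j < c.J, ∀ a b, R (c.link 2 j) a b →
        (R (c.hatB B) (s a b) (s b a) ↔ R B a b) ∧ (R (c.hatB B) (s b a) (s a b) ↔ R B b a) := by
      intro j hj a b h
      have h' := (hlink j hj a b).2 h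
      rw [← hB.fwd j hj _ hE' _ _ h', ← hA.fwd j hj B hBC a b h,
        ← hB.bwd j hj _ hE' _ _ h', ← hA.bwd j hj B hBC a b h]
      exact ⟨hsr a b _ (fwd_mem hj hE'), hsr a b _ (bwd_mem hj hE')⟩
    by_cases hab : a = b
    · subst hab
      rw [← hB.loop _ hE', ← hA.loop B hBC]
      exact hsr a a _ (loop_mem hE')
    · by_cases hl : ∃ j < c.J, R (c.link 2 j) a b ∨ R (c.link 2 j) b a
      · obtain ⟨j, hj, h | h⟩ := hl
        · exact (hedge j hj a b h).1
        · exact (hedge j hj b a h).2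
      -- Off the links both copies of a bounded relation are empty: the copy holds only along the
      -- links of its own side, and these have been turned into the links of the other side.
      · refine iff_of_false (fun h => hl ?_)
          (fun h => hl ((hA.edge a b hab).2 ⟨B, hBC, Or.inl h⟩))
        rcases hB.edge B hBC _ _ h with h | ⟨j, hj, h⟩
        · exact absurd ((hs a b).1 h) hab
        · exact ⟨j, hj, by rwa [hlink j hj, hlink j hj] at h⟩

/-- Every binary relation is read from its renamed copy at the exchanged pairs. On `C` this returns
the original relations, so `α` and the Gaifman graph are untouched, whether or not `C` and `D` share
binary symbols. -/
theorem exists_model_of_separated [Finite V] [Nonempty V] {α β : Formula} (hα : α ∈ MSO c.C)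
    (hβ : β ∈ C2 c.D) (hqs : c.qs = β.quants c.base) (N : Str (c.C' ∪ c.D') V)
    (hNα : N.Models (c.alpha' α)) (hNβ : N.Models (c.beta' β)) :
    ∃ M : Str (c.C ∪ c.D) V, M.Models α ∧ M.Models β ∧
      (M.reduct (Vocab.subset_union_left c.C c.D)).gaifman =
        (N.reduct (Vocab.subset_union_left c.C' c.D')).gaifman := by
  classical
  rw [Str.models_iff] at hNα hNβ
  have hA : AlphaSpec c N.totUn N.totBin := forall_holds_alphaAx.1
    (forall_holds_all.1 (forall_holds_all.1 (forall_holds_all.1 fun e s r => (hNα e s r).2)))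
  have hB : BetaSpec c N.totUn N.totBin := forall_holds_betaAx.1
    (forall_holds_all.1 (forall_holds_all.1 fun e s r => (hNβ e s r).2))
  obtain ⟨s, hs, hU, hwit, hshared⟩ := exists_rewired hA hB
  let R' : ℕ → V → V → Prop := fun B a b => N.totBin (c.hatB B) (s a b) (s b a)
  refine ⟨Str.ofTotal _ N.totUn R', ?_, ?_, ?_⟩
  · rw [Str.models_ofTotal hα.2.1 (Vocab.subset_union_left _ _)]
    exact fun e S Z => (holds_congr (fun _ _ _ => Iff.rfl) hshared hα.2.1).2 (hNα e S Z).1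
  · rw [Str.models_ofTotal hβ.2.1 (Vocab.subset_union_right _ _)]
    intro e S Z
    let e' : ℕ → V := fun v => if v = 0 then s (e 0) (e 1) else s (e 1) (e 0)
    refine (holds_iff_holds_hat hs hU (fun _ _ _ _ => Iff.rfl)
      (fun B h => hB.loop _ (hatB_mem_right h)) hwit hB.wit hβ.1 hβ.2.1 (fun q h => hqs ▸ h)
      (e' := e') ?_ ?_).2 (hNβ e' S Z).1
    · simp [e']
    · simp [e']
  · ext a b
    rw [Str.gaifman_reduct_adj, Str.gaifman_reduct_adj]
    refine and_congr_right fun hab => ?_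
    have h1 : ∀ B ∈ c.C.bin, ∀ a b,
        (Str.ofTotal (c.C ∪ c.D) N.totUn R').totBin B a b ↔ N.totBin B a b := fun B h a b =>
      (⟨fun h' => h'.2, fun h' => ⟨List.mem_append_left _ h, h'⟩⟩ : _ ↔ R' B a b).trans
        (hshared B h a b)
    constructor
    · rintro ⟨B, h, h'⟩
      rw [h1 B h, h1 B h] at h'
      exact ⟨B, List.mem_append_left _ h, h'⟩
    · rintro ⟨B, h, h'⟩
      have : ∃ B ∈ c.C.bin, N.totBin B a b ∨ N.totBin B b a := by
        rcases List.mem_append.1 h with h | h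
        · exact ⟨B, h, h'⟩
        · obtain ⟨j, hj, rfl⟩ := List.mem_map.1 h
          exact (hA.edge a b hab).1 ⟨j, List.mem_range.1 hj, h'⟩
      obtain ⟨B, h, h'⟩ := this
      refine ⟨B, h, ?_⟩
      rwa [h1 B h, h1 B h]

end SepCtx

/-! ## From models of the original sentences to models of the separated ones -/

/-- The kinds of new symbols occupy distinct residue classes above `base`, modulo `4` for binary and
`8` for unary symbols, and so can be interpreted independently. -/
theorem exists_interpretation {X : Type*} (base d : ℕ) (g₀ : ℕ → X) (f : ℕ → ℕ → X) :
    ∃ g : ℕ → X, (∀ n < base, g n = g₀ n) ∧ ∀ t < d, ∀ i, g (base + d * i + t) = f t i := by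
  refine ⟨fun n => if n < base then g₀ n else f ((n - base) % d) ((n - base) / d),
    fun n hn => if_pos hn, fun t ht i => ?_⟩
  have h1 : ¬ base + d * i + t < base := by omega
  have h2 : base + d * i + t - base = t + d * i := by omega
  simp only [h1, if_false, h2]
  rw [Nat.add_mul_mod_self_left, Nat.mod_eq_of_lt ht, Nat.add_mul_div_left _ _ (by omega),
    Nat.div_eq_of_lt ht, zero_add]

theorem encard_exists_mem_le {V : Type u} (l : List ℕ) (W : ℕ → Set V) (f : ℕ → ℕ)
    (h : ∀ q ∈ l, (W q).encard ≤ f q) :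
    {b | ∃ q ∈ l, b ∈ W q}.encard ≤ ((l.foldr (fun q m => f q + m) 0 : ℕ) : ℕ∞) := by
  induction l with
  | nil => simp
  | cons q l ih =>
    have : {b | ∃ p ∈ q :: l, b ∈ W p} = W q ∪ {b | ∃ p ∈ l, b ∈ W p} := by ext; simp
    rw [this, List.foldr_cons, Nat.cast_add]
    exact (Set.encard_union_le _ _).trans (add_le_add (h q List.mem_cons_self)
      (ih fun p hp => h p (List.mem_cons_of_mem _ hp)))

namespace SepCtx

open Formula

/-- A bound on the number of witnesses of an element. -/
def witBound (qs : List ℕ) : ℕ := qs.foldr (fun q m => q.unpair.1 + m) 0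

/-- A sufficient number of colours. -/
def colorBound (K : ℕ) (qs : List ℕ) : ℕ := 2 * ((K + witBound qs) * (K + witBound qs)) + 1

variable {c : SepCtx} {V : Type u}

/-- The expansion of a given model: choose the witnesses, obtain links and colours for the
orientation together with the witness relation, let both versions of the links be the same, and let
the unary symbols record what they are meant to record. -/
theorem exists_spec [Finite V] (U₀ : ℕ → V → Prop) (R₀ : ℕ → V → V → Prop)
    (hCu : ∀ P ∈ c.C.un, P < c.base) (hCb : ∀ B ∈ c.C.bin, B < c.base)
    (hDu : ∀ P ∈ c.D.un, P < c.base)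
    (hqs : ∀ q ∈ c.qs, q.unpair.2.unpair.1 < 2 ∧ (ofCode q.unpair.2.unpair.2).IsC2 ∧
      (ofCode q.unpair.2.unpair.2).Over ⟨c.D.un, c.D.bin.map c.hatB⟩)
    (hQ : c.Q = colorBound c.K c.qs) (o : V → V → Prop)
    (ho : ∀ a b, o a b → ¬ o b a) (hoK : ∀ a, {b | o a b}.encard ≤ c.K)
    (hoR : ∀ a b, o a b ∨ o b a ↔ a ≠ b ∧ ∃ B ∈ c.C.bin, R₀ B a b ∨ R₀ B b a) :
    ∃ (U : ℕ → V → Prop) (R : ℕ → V → V → Prop),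
      (∀ P, (P ∈ c.C.un ∨ P ∈ c.D.un) → U P = U₀ P) ∧ (∀ B ∈ c.C.bin, R B = R₀ B) ∧
      (∀ B, R (c.hatB B) = R₀ B) ∧ AlphaSpec c U R ∧ BetaSpec c U R := by
  classical
  -- Undoes the renaming, so that the renamed subformulas can be evaluated before the new relations
  -- are defined.
  let Rh : ℕ → V → V → Prop := fun E => R₀ ((E - c.base) / 4)
  let S : ℕ → V → Set V := fun q a => {b | Holds U₀ Rh
    (Function.update (fun _ => a) q.unpair.2.unpair.1 b) (fun _ => ∅) (fun _ _ _ => False)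
    (ofCode q.unpair.2.unpair.2)}
  -- Cutting off at `n` bounds the out-degree of the witness relations independently of the model.
  have hW : ∀ q a, ∃ T ⊆ S q a, T.encard = min (q.unpair.1 : ℕ∞) (S q a).encard := fun q a =>
    Set.exists_subset_encard_eq (min_le_right _ _)
  choose W hWS hWcard using hW
  obtain ⟨col, h, hcol, hcoloring, hJ, hfun, hirr, hdisj, hdir, hsym, hedge, hmsg⟩ :=
    exists_links o (fun a b => ∃ q ∈ c.qs, b ∈ W q a) c.K (witBound c.qs) c.Q ho hoK
      (fun a => encard_exists_mem_le c.qs (fun q => W q a) (fun q => q.unpair.1) fun q _ => by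
        rw [hWcard]; exact min_le_left _ _) hQ
  obtain ⟨R, hR₀, hR⟩ := exists_interpretation c.base 4 R₀ fun t i =>
    match t with
    | 0 => R₀ i
    | 1 => fun a b => b ∈ W i a
    | _ => h i
  have hRhat : ∀ B, R (c.hatB B) = R₀ B := fun B => hR 0 (by norm_num) B
  have hRwit : ∀ q, R (c.wit q) = fun a b => b ∈ W q a := fun q => hR 1 (by norm_num) q
  have hRl2 : ∀ j, R (c.link 2 j) = h j := fun j => hR 2 (by norm_num) j
  have hRl3 : ∀ j, R (c.link 3 j) = h j := fun j => hR 3 (by norm_num) j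
  let f : (ℕ → V → Prop) → ℕ → ℕ → V → Prop := fun U₁ t i =>
    match t with
    | 0 => fun a => (i.unpair.1 : ℕ∞) ≤ (S i a).encard
    | 1 => fun a => col a = i
    | 2 => fun a => R i a a
    | 3 => fun a => ∃ b, h i.unpair.1 a b ∧ R i.unpair.2 a b
    | 4 => fun a => ∃ b, h i.unpair.1 a b ∧ R i.unpair.2 b a
    | 5 => fun a => ∃ b, h i a b
    | _ => fun a => ∃ b, h i.unpair.1 a b ∧ U₁ i.unpair.2 b
  -- Two rounds, because `succ` refers to the interpretation of the type symbols. These are final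
  -- after the first round, as none of them depends on `succ`.
  obtain ⟨U₁, hU₁0, hU₁⟩ := exists_interpretation c.base 8 U₀ (f U₀)
  obtain ⟨U, hU0, hU⟩ := exists_interpretation c.base 8 U₀ (f U₁)
  have hUtruth : ∀ q, U (c.truth q) = fun a => (q.unpair.1 : ℕ∞) ≤ (S q a).encard :=
    fun q => hU 0 (by norm_num) q
  have hUcol : ∀ q, U (c.color q) = fun a => col a = q := fun q => hU 1 (by norm_num) q
  have hUloop : ∀ E, U (c.loop E) = fun a => R E a a := fun E => hU 2 (by norm_num) E
  have hUfwd : ∀ j E, U (c.fwd j E) = fun a => ∃ b, h j a b ∧ R E a b := fun j E => by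
    have := hU 3 (by norm_num) (Nat.pair j E)
    simp only [f, Nat.unpair_pair] at this
    exact this
  have hUbwd : ∀ j E, U (c.bwd j E) = fun a => ∃ b, h j a b ∧ R E b a := fun j E => by
    have := hU 4 (by norm_num) (Nat.pair j E)
    simp only [f, Nat.unpair_pair] at this
    exact this
  have hUdom : ∀ j, U (c.dom j) = fun a => ∃ b, h j a b := fun j => hU 5 (by norm_num) j
  have hUU₁ : ∀ P ∈ c.unType, U₁ P = U P := by
    intro P hP
    rcases mem_unType.1 hP with hP | ⟨q, -, rfl⟩ | ⟨q, -, rfl⟩ | ⟨E, -, rfl⟩ | ⟨j, -, E, -, rfl⟩ |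
      ⟨j, -, E, -, rfl⟩
    · rw [hU0 P (hDu P hP), hU₁0 P (hDu P hP)]
    · exact (hU₁ 0 (by norm_num) q).trans (hU 0 (by norm_num) q).symm
    · exact (hU₁ 1 (by norm_num) q).trans (hU 1 (by norm_num) q).symm
    · exact (hU₁ 2 (by norm_num) E).trans (hU 2 (by norm_num) E).symm
    · exact (hU₁ 3 (by norm_num) _).trans (hU 3 (by norm_num) _).symm
    · exact (hU₁ 4 (by norm_num) _).trans (hU 4 (by norm_num) _).symm
  have hUsucc : ∀ j, ∀ P ∈ c.unType, U (c.succ j P) = fun a => ∃ b, h j a b ∧ U P b :=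
    fun j P hP => by
      have := hU 6 (by norm_num) (Nat.pair j P)
      simp only [f, Nat.unpair_pair, hUU₁ P hP] at this
      exact this
  have hval : ∀ j a b, h j a b → ∀ Φ : V → Prop, (∃ b', h j a b' ∧ Φ b') ↔ Φ b :=
    fun j a b hab Φ => ⟨fun ⟨b', h1, h2⟩ => hfun j a b b' hab h1 ▸ h2, fun h2 => ⟨b, hab, h2⟩⟩
  have hspec : ∀ t, (∀ j, R (c.link t j) = h j) → LinkSpec c U R t := by
    intro t ht
    constructor
    · intro j hj a b hab hne
      rw [ht, hne] at hab
      exact hirr j b hab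
    · intro j hj a
      rw [ht, hUdom]
    · intro j hj i hi a b h1 h2
      rw [ht] at h1 h2
      exact hi.ne (hdisj i j a b h2 h1)
    · intro j hj P hP a b hab
      rw [ht] at hab
      rw [hUsucc j P hP]
      exact hval j a b hab _
    · intro i hi a b hab
      rw [ht] at hab ⊢
      exact hsym _ a b (Nat.le_add_right _ _) hab
  have hMsg : ∀ a b, c.Msg R a b ↔ (∃ q ∈ c.qs, b ∈ W q a) ∨ o a b := by
    intro a b
    rw [← hmsg, Msg]
    simp only [hRwit, hRl3]
    exact or_congr_right ⟨fun ⟨j, _, hj⟩ => ⟨j, hj⟩, fun ⟨j, hj⟩ => ⟨j, hJ j a b hj, hj⟩⟩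
  have hlink : ∀ j a b, h j a b → c.Msg R a b := fun j a b hj => by
    rw [hMsg, ← hmsg]; exact Or.inr ⟨j, hj⟩
  have hadj : ∀ a b, (∃ j < c.J, h j a b ∨ h j b a) ↔
      a ≠ b ∧ ∃ B ∈ c.C.bin, R₀ B a b ∨ R₀ B b a := by
    intro a b
    rw [← hoR, ← hedge]
    exact ⟨fun ⟨j, _, hj⟩ => ⟨j, hj⟩, fun ⟨j, hj⟩ => ⟨j, hj.elim (hJ j a b) (hJ j b a), hj⟩⟩
  refine ⟨U, R, fun P hP => hU0 P (hP.elim (hCu P) (hDu P)), fun B hB => hR₀ B (hCb B hB), hRhat,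
    ⟨hspec 2 hRl2, ?_, ?_, ?_, ?_, ?_, ?_⟩,
    ⟨hspec 3 hRl3, ?_, ?_, ?_, ?_, ?_, ?_, ?_, ?_, ?_⟩⟩
  · intro j _ a b b' h1 h2
    rw [hRl2] at h1 h2
    exact hfun j a b b' h1 h2
  · intro j hj i hi a b h1 h2
    rw [hRl2] at h1 h2
    exact hdir j a b hj h1 ((hMsg b a).1 (hlink i b a h2))
  · intro j _ B hB a b hab
    rw [hRl2] at hab
    rw [hUfwd, hRhat, hR₀ B (hCb B hB)]
    exact hval j a b hab _
  · intro j _ B hB a b hab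
    rw [hRl2] at hab
    rw [hUbwd, hRhat, hR₀ B (hCb B hB)]
    exact hval j a b hab fun b => R₀ B b a
  · intro B hB a
    rw [hUloop, hRhat, hR₀ B (hCb B hB)]
  · intro a b hab
    simp only [hRl2]
    rw [hadj]
    refine (and_iff_right hab).trans (exists_congr fun B => and_congr_right fun hB => ?_)
    rw [hR₀ B (hCb B hB)]
  · intro j _ a b b' h1 h2
    rw [hRl3] at h1 h2
    exact hfun j a b b' h1 h2
  · intro j hj a b h1
    rw [hRl3] at h1
    rw [hMsg]
    exact hdir j a b hj h1
  · intro j _ E _ a b hab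
    rw [hRl3] at hab
    rw [hUfwd]
    exact hval j a b hab _
  · intro j _ E _ a b hab
    rw [hRl3] at hab
    rw [hUbwd]
    exact hval j a b hab fun b => R E b a
  · intro E _ a
    rw [hUloop]
  · intro B hB a b hab
    rw [hRhat] at hab
    simp only [hRl3]
    rw [hadj]
    by_cases h : a = b
    · exact Or.inl h
    · exact Or.inr ⟨h, B, hB, Or.inl hab⟩
  · intro a
    exact ⟨col a, hcol a, by rw [hUcol]⟩
  · intro q _ a b b' h1 h2 h3 h4
    rw [hUcol] at h3 h4
    exact hcoloring a b b' ((hMsg _ _).1 h1) ((hMsg _ _).1 h2) (h3.trans h4.symm)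
  · intro q hq e s r
    obtain ⟨hx, hC2, hover⟩ := hqs q hq
    have hne : 1 - q.unpair.2.unpair.1 ≠ q.unpair.2.unpair.1 := by omega
    have hφ : ∀ e s r, Holds U R e s r (ofCode q.unpair.2.unpair.2) ↔
        e q.unpair.2.unpair.1 ∈ S q (e (1 - q.unpair.2.unpair.1)) := by
      intro e s r
      rw [holds_congr (U' := U₀) (R' := Rh) (fun P hP a => by rw [hU0 P (hDu P hP)])
        (fun B hB a b => ?_) hover]
      · refine holds_congr_assignment hC2 ?_ ?_ <;>
        · generalize q.unpair.2.unpair.1 = x at hx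
          interval_cases x <;> simp
      · obtain ⟨B, -, rfl⟩ := List.mem_map.1 hB
        have : (c.hatB B - c.base) / 4 = B := by unfold hatB; omega
        simp only [Rh, hRhat, this]
    simp only [witAx, holds_and, holds_imp, holds_iff, holds_neg, holds_un, holds_bin, holds_exGe,
      Function.update_self, Function.update_of_ne hne, hφ, hRwit, hUtruth]
    refine ⟨fun h => hWS _ _ h, fun ⟨h1, h2⟩ => ?_, ?_⟩
    · rw [not_le] at h2
      have h3 := hWcard q (e (1 - q.unpair.2.unpair.1))
      rw [min_eq_right h2.le] at h3
      rwa [(Set.toFinite _).eq_of_subset_of_encard_le (hWS _ _) h3.ge]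
    · change _ ↔ _ ≤ (W q _).encard
      rw [hWcard]
      simp

theorem exists_separated_model [Finite V] [Nonempty V] {α β : Formula} (hα : α ∈ MSO c.C)
    (hβ : β ∈ C2 c.D) (hqs : c.qs = β.quants c.base) (hQ : c.Q = colorBound c.K c.qs)
    (hCu : ∀ P ∈ c.C.un, P < c.base) (hCb : ∀ B ∈ c.C.bin, B < c.base)
    (hDu : ∀ P ∈ c.D.un, P < c.base) (M : Str (c.C ∪ c.D) V) (hMα : M.Models α)
    (hMβ : M.Models β)
    (hM : (M.reduct (Vocab.subset_union_left c.C c.D)).gaifman.IsKBounded (c.K + 1)) :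
    ∃ N : Str (c.C' ∪ c.D') V, N.Models (c.alpha' α) ∧ N.Models (c.beta' β) ∧
      (N.reduct (Vocab.subset_union_left c.C' c.D')).gaifman =
        (M.reduct (Vocab.subset_union_left c.C c.D)).gaifman := by
  rw [Str.models_iff] at hMα hMβ
  obtain ⟨o, hoG, ho, hoK⟩ := hM
  obtain ⟨U, R, hU, hRC, hRD, hA, hB⟩ := exists_spec M.totUn M.totBin hCu hCb hDu
    (by
      rw [hqs]
      exact quants_spec hβ.2.1 hβ.1 (fun P hP => hP) (fun B hB => List.mem_map_of_mem hB))
    hQ o ho (fun a => Order.lt_add_one_iff_of_not_isMax (by simp) |>.1 (by exact_mod_cast hoK a))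
    (fun a b => (hoG a b).symm.trans (Str.gaifman_reduct_adj M _ a b))
  refine ⟨Str.ofTotal _ U R, ?_, ?_, ?_⟩
  · rw [Str.models_ofTotal (alpha'_mem hα).2.1 (Vocab.subset_union_left _ _)]
    exact fun e s r =>
      ⟨(holds_congr (fun P hP a => by rw [hU P (Or.inl hP)]) (fun B hB a b => by rw [hRC B hB])
        hα.2.1).2 (hMα e s r),
      forall_holds_all.2 (forall_holds_all.2 (forall_holds_all.2 (forall_holds_alphaAx.2 hA)))
        e s r⟩
  · rw [Str.models_ofTotal (beta'_mem hβ hqs).2.1 (Vocab.subset_union_right _ _)]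
    exact fun e s r =>
      ⟨(holds_hat hβ.1).2 ((holds_congr (fun P hP a => by rw [hU P (Or.inr hP)])
        (fun B _ a b => iff_of_eq (congrFun₂ (hRD B) a b)) hβ.2.1).2 (hMβ e s r)),
      forall_holds_all.2 (forall_holds_all.2 (forall_holds_betaAx.2 hB)) e s r⟩
  · ext a b
    rw [Str.gaifman_reduct_adj, Str.gaifman_reduct_adj]
    refine and_congr_right fun hab => ?_
    have h1 : ∀ B ∈ c.C'.bin, ∀ a b,
        (Str.ofTotal (c.C' ∪ c.D') U R).totBin B a b ↔ R B a b := fun B h a b =>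
      ⟨fun h' => h'.2, fun h' => ⟨List.mem_append_left _ h, h'⟩⟩
    constructor
    · rintro ⟨B, h, h'⟩
      rw [h1 B h, h1 B h] at h'
      have : ∃ B ∈ c.C.bin, R B a b ∨ R B b a := by
        rcases List.mem_append.1 h with h | h
        · exact ⟨B, h, h'⟩
        · obtain ⟨j, hj, rfl⟩ := List.mem_map.1 h
          exact (hA.edge a b hab).1 ⟨j, List.mem_range.1 hj, h'⟩
      obtain ⟨B, h, h'⟩ := this
      exact ⟨B, h, by rwa [hRC B h] at h'⟩
    · rintro ⟨B, h, h'⟩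
      have h2 : B ∈ c.C'.bin := List.mem_append_left _ h
      refine ⟨B, h2, ?_⟩
      rw [h1 B h2, h1 B h2, hRC B h]
      exact h'

end SepCtx

/-! ## Computability -/

-- Closure properties of primitive recursive functions.

attribute [fun_prop] Primrec

namespace Primrec

variable {α β γ : Type*} [Primcodable α] [Primcodable β] [Primcodable γ]

@[fun_prop] theorem fun_id : Primrec fun x : α => x := Primrec.id

@[fun_prop] theorem fun_const (y : β) : Primrec fun _ : α => y := Primrec.const y

@[fun_prop] theorem fun_comp {f : β → γ} {g : α → β} (hf : Primrec f) (hg : Primrec g) :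
    Primrec fun x => f (g x) := hf.comp hg

@[fun_prop] theorem fun_pair {f : α → β} {g : α → γ} (hf : Primrec f) (hg : Primrec g) :
    Primrec fun x => (f x, g x) := hf.pair hg

@[fun_prop] theorem fun_fst {f : α → β × γ} (hf : Primrec f) : Primrec fun x => (f x).1 :=
  Primrec.fst.comp hf

@[fun_prop] theorem fun_snd {f : α → β × γ} (hf : Primrec f) : Primrec fun x => (f x).2 :=
  Primrec.snd.comp hf

@[fun_prop] theorem fun_add {f g : α → ℕ} (hf : Primrec f) (hg : Primrec g) :
    Primrec fun x => f x + g x := Primrec.nat_add.comp hf hg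

@[fun_prop] theorem fun_sub {f g : α → ℕ} (hf : Primrec f) (hg : Primrec g) :
    Primrec fun x => f x - g x := Primrec.nat_sub.comp hf hg

@[fun_prop] theorem fun_mul {f g : α → ℕ} (hf : Primrec f) (hg : Primrec g) :
    Primrec fun x => f x * g x := Primrec.nat_mul.comp hf hg

@[fun_prop] theorem fun_div {f g : α → ℕ} (hf : Primrec f) (hg : Primrec g) :
    Primrec fun x => f x / g x := Primrec.nat_div.comp hf hg

@[fun_prop] theorem fun_mod {f g : α → ℕ} (hf : Primrec f) (hg : Primrec g) :
    Primrec fun x => f x % g x := Primrec.nat_mod.comp hf hg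

@[fun_prop] theorem fun_natPair {f g : α → ℕ} (hf : Primrec f) (hg : Primrec g) :
    Primrec fun x => Nat.pair (f x) (g x) := Primrec₂.natPair.comp hf hg

@[fun_prop] theorem fun_unpair {f : α → ℕ} (hf : Primrec f) : Primrec fun x => (f x).unpair :=
  Primrec.unpair.comp hf

@[fun_prop] theorem fun_cons {f : α → β} {g : α → List β} (hf : Primrec f) (hg : Primrec g) :
    Primrec fun x => f x :: g x := Primrec.list_cons.comp hf hg

@[fun_prop] theorem fun_append {f g : α → List β} (hf : Primrec f) (hg : Primrec g) :
    Primrec fun x => f x ++ g x := Primrec.list_append.comp hf hg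

@[fun_prop] theorem fun_length {f : α → List β} (hf : Primrec f) :
    Primrec fun x => (f x).length := Primrec.list_length.comp hf

@[fun_prop] theorem fun_range {f : α → ℕ} (hf : Primrec f) :
    Primrec fun x => List.range (f x) := Primrec.list_range.comp hf

@[fun_prop] theorem fun_getD {f : α → List β} {n : α → ℕ} {d : β} (hf : Primrec f)
    (hn : Primrec n) : Primrec fun x => (f x).getD (n x) d := (Primrec.list_getD d).comp hf hn

@[fun_prop] theorem fun_map {f : α → List β} {g : α → β → γ} (hf : Primrec f)
    (hg : Primrec fun p : α × β => g p.1 p.2) : Primrec fun x => (f x).map (g x) :=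
  Primrec.list_map hf hg

@[fun_prop] theorem fun_flatMap {f : α → List β} {g : α → β → List γ} (hf : Primrec f)
    (hg : Primrec fun p : α × β => g p.1 p.2) : Primrec fun x => (f x).flatMap (g x) :=
  Primrec.list_flatMap hf hg

@[fun_prop] theorem fun_foldr {f : α → List β} {g : α → β → γ → γ} {i : α → γ} (hf : Primrec f)
    (hi : Primrec i) (hg : Primrec fun p : α × β × γ => g p.1 p.2.1 p.2.2) :
    Primrec fun x => (f x).foldr (g x) (i x) :=
  Primrec.list_foldr (h := fun x p => g x p.1 p.2) hf hi hg

theorem ite_eq {f : α → ℕ} {n : ℕ} {g h : α → β} (hf : Primrec f) (hg : Primrec g)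
    (hh : Primrec h) : Primrec fun x => if f x = n then g x else h x :=
  Primrec.ite (Primrec.eq.comp hf (Primrec.const n)) hg hh

end Primrec

namespace Vocab

variable {α : Type*} [Primcodable α]

@[fun_prop] theorem primrec_mk {f g : α → List ℕ} (hf : Primrec f) (hg : Primrec g) :
    Primrec fun x => Vocab.mk (f x) (g x) :=
  (Primrec.of_equiv_iff equivLists).1 (hf.pair hg)

@[fun_prop] theorem primrec_un {f : α → Vocab} (hf : Primrec f) : Primrec fun x => (f x).un :=
  Primrec.fst.comp ((Primrec.of_equiv_iff equivLists).2 hf)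

@[fun_prop] theorem primrec_bin {f : α → Vocab} (hf : Primrec f) : Primrec fun x => (f x).bin :=
  Primrec.snd.comp ((Primrec.of_equiv_iff equivLists).2 hf)

end Vocab

/-! ### Primitive recursiveness of the operations on formulas. -/

namespace Formula

variable {α : Type*} [Primcodable α]

@[fun_prop] theorem primrec_code {f : α → Formula} (hf : Primrec f) :
    Primrec fun x => (f x).code := (Primrec.of_equiv_iff equivNat).2 hf

theorem primrec_of_code {f : α → Formula} (hf : Primrec fun x => (f x).code) : Primrec f :=
  (Primrec.of_equiv_iff equivNat).1 hf

@[fun_prop] theorem primrec_ofCode {f : α → ℕ} (hf : Primrec f) : Primrec fun x => ofCode (f x) :=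
  primrec_of_code (by simpa only [code_ofCode] using hf)

variable {n m k : α → ℕ} {φ ψ : α → Formula}

@[fun_prop] theorem primrec_eq (hn : Primrec n) (hm : Primrec m) :
    Primrec fun x => eq (n x) (m x) := primrec_of_code (by simp only [code]; fun_prop)

@[fun_prop] theorem primrec_un (hn : Primrec n) (hm : Primrec m) :
    Primrec fun x => un (n x) (m x) := primrec_of_code (by simp only [code]; fun_prop)

@[fun_prop] theorem primrec_bin (hn : Primrec n) (hm : Primrec m) (hk : Primrec k) :
    Primrec fun x => bin (n x) (m x) (k x) := primrec_of_code (by simp only [code]; fun_prop)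

@[fun_prop] theorem primrec_neg (hφ : Primrec φ) : Primrec fun x => neg (φ x) :=
  primrec_of_code (by simp only [code]; fun_prop)

@[fun_prop] theorem primrec_and (hφ : Primrec φ) (hψ : Primrec ψ) :
    Primrec fun x => Formula.and (φ x) (ψ x) := primrec_of_code (by simp only [code]; fun_prop)

@[fun_prop] theorem primrec_ex (hn : Primrec n) (hφ : Primrec φ) :
    Primrec fun x => ex (n x) (φ x) := primrec_of_code (by simp only [code]; fun_prop)

@[fun_prop] theorem primrec_exGe (hn : Primrec n) (hm : Primrec m) (hφ : Primrec φ) :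
    Primrec fun x => exGe (n x) (m x) (φ x) := primrec_of_code (by simp only [code]; fun_prop)

@[fun_prop] theorem primrec_imp (hφ : Primrec φ) (hψ : Primrec ψ) :
    Primrec fun x => imp (φ x) (ψ x) := by unfold imp; fun_prop

@[fun_prop] theorem primrec_iff (hφ : Primrec φ) (hψ : Primrec ψ) :
    Primrec fun x => Formula.iff (φ x) (ψ x) := by unfold Formula.iff; fun_prop

@[fun_prop] theorem primrec_or (hφ : Primrec φ) (hψ : Primrec ψ) :
    Primrec fun x => Formula.or (φ x) (ψ x) := by unfold Formula.or; fun_prop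

@[fun_prop] theorem primrec_all (hn : Primrec n) (hφ : Primrec φ) :
    Primrec fun x => all (n x) (φ x) := by unfold all; fun_prop

@[fun_prop] theorem primrec_atMostOne (hn : Primrec n) (hφ : Primrec φ) :
    Primrec fun x => atMostOne (n x) (φ x) := by unfold atMostOne; fun_prop

@[fun_prop] theorem primrec_allOver {l : α → List ℕ} {g : α → ℕ → Formula} (hl : Primrec l)
    (hg : Primrec fun p : α × ℕ => g p.1 p.2) : Primrec fun x => allOver (l x) (g x) := by
  have : Primrec fun p : α × ℕ × Formula => g p.1 p.2.1 :=
    hg.comp (Primrec.fst.pair (Primrec.fst.comp Primrec.snd))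
  unfold allOver
  fun_prop

@[fun_prop] theorem primrec_anyOver {l : α → List ℕ} {g : α → ℕ → Formula} (hl : Primrec l)
    (hg : Primrec fun p : α × ℕ => g p.1 p.2) : Primrec fun x => anyOver (l x) (g x) := by
  unfold anyOver
  fun_prop

/-- One step of the simultaneous computation of `hat` and `quants` by recursion on codes: the
list contains the results for all formulas with smaller codes. -/
def scanStep (b : ℕ) (l : List (Formula × List ℕ)) : Formula × List ℕ :=
  let m := l.length
  let p := (m / 11).unpair
  let res := fun i => l.getD i (eq 0 0, [])
  if m % 11 = 2 then (bin (b + 4 * p.1) p.2.unpair.1 p.2.unpair.2, [])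
  else if m % 11 = 5 then (neg (res (m / 11)).1, (res (m / 11)).2)
  else if m % 11 = 6 then (.and (res p.1).1 (res p.2).1, (res p.1).2 ++ (res p.2).2)
  else if m % 11 = 7 then
    (ex p.1 (res p.2).1, Nat.pair 1 (Nat.pair p.1 (res p.2).1.code) :: (res p.2).2)
  else if m % 11 = 8 then
    (exGe p.1 p.2.unpair.1 (res p.2.unpair.2).1,
      Nat.pair p.1 (Nat.pair p.2.unpair.1 (res p.2.unpair.2).1.code) :: (res p.2.unpair.2).2)
  -- Covers the atoms without a binary symbol and the second order quantifiers, which renaming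
  -- leaves unchanged.
  else (ofCode m, [])

theorem primrec_scanStep : Primrec fun x : ℕ × List (Formula × List ℕ) => scanStep x.1 x.2 := by
  unfold scanStep
  refine Primrec.ite_eq ?_ ?_ (Primrec.ite_eq ?_ ?_ (Primrec.ite_eq ?_ ?_ (Primrec.ite_eq ?_ ?_
    (Primrec.ite_eq ?_ ?_ ?_)))) <;> fun_prop

/-- Immediate subformulas have smaller codes, so the list holds their results and the default is not
used. Both functions are computed together because `quants` needs the codes of the renamed
subformulas. -/
theorem scanStep_range (b n : ℕ) :
    scanStep b ((List.range n).map fun m => ((ofCode m).hat b, (ofCode m).quants b)) =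
      ((ofCode n).hat b, (ofCode n).quants b) := by
  have hget : ∀ φ : Formula, φ.code < n →
      ((List.range n).map fun m => ((ofCode m).hat b, (ofCode m).quants b)).getD φ.code
        (eq 0 0, []) = (φ.hat b, φ.quants b) := by
    intro φ h
    simp [List.getD_eq_getElem?_getD, h, ofCode_code]
  have hl : ∀ a b : ℕ, a ≤ Nat.pair a b := Nat.left_le_pair
  have hr : ∀ a b : ℕ, b ≤ Nat.pair a b := Nat.right_le_pair
  obtain ⟨φ, rfl⟩ : ∃ φ : Formula, φ.code = n := ⟨ofCode n, code_ofCode n⟩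
  rw [ofCode_code]
  cases φ with
  | neg φ =>
    have h1 := hget φ (by simp only [code]; omega)
    have h2 : φ.neg.code / 11 = φ.code := by simp only [code]; omega
    have h3 : φ.neg.code % 11 = 5 := by simp only [code]; omega
    simp only [scanStep, List.length_map, List.length_range, h2, h3, h1]
    rfl
  | and φ ψ =>
    have h1 := hget φ (by simp only [code]; have := hl φ.code ψ.code; omega)
    have h1' := hget ψ (by simp only [code]; have := hr φ.code ψ.code; omega)
    have h2 : (φ.and ψ).code / 11 = Nat.pair φ.code ψ.code := by simp only [code]; omega
    have h3 : (φ.and ψ).code % 11 = 6 := by simp only [code]; omega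
    simp only [scanStep, List.length_map, List.length_range, h2, h3, Nat.unpair_pair, h1, h1']
    rfl
  | ex x φ =>
    have h1 := hget φ (by simp only [code]; have := hr x φ.code; omega)
    have h2 : (ex x φ).code / 11 = Nat.pair x φ.code := by simp only [code]; omega
    have h3 : (ex x φ).code % 11 = 7 := by simp only [code]; omega
    simp only [scanStep, List.length_map, List.length_range, h2, h3, Nat.unpair_pair, h1]
    rfl
  | exGe n x φ =>
    have h1 := hget φ (by
      simp only [code]
      have := hr x φ.code
      have := hr n (Nat.pair x φ.code)
      omega)
    have h2 : (exGe n x φ).code / 11 = Nat.pair n (Nat.pair x φ.code) := by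
      simp only [code]; omega
    have h3 : (exGe n x φ).code % 11 = 8 := by simp only [code]; omega
    simp only [scanStep, List.length_map, List.length_range, h2, h3, Nat.unpair_pair, h1]
    rfl
  | bin B x y =>
    have h2 : (bin B x y).code / 11 = Nat.pair B (Nat.pair x y) := by simp only [code]; omega
    have h3 : (bin B x y).code % 11 = 2 := by simp only [code]; omega
    simp only [scanStep, List.length_map, List.length_range, h2, h3, Nat.unpair_pair]
    rfl
  | _ =>
    simp only [scanStep, List.length_map, List.length_range, ofCode_code]
    rw [if_neg (by simp only [code]; omega), if_neg (by simp only [code]; omega),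
      if_neg (by simp only [code]; omega), if_neg (by simp only [code]; omega),
      if_neg (by simp only [code]; omega)]
    rfl

theorem primrec_scan {b : α → ℕ} (hb : Primrec b) (hφ : Primrec φ) :
    Primrec fun x => ((φ x).hat (b x), (φ x).quants (b x)) := by
  have := Primrec.nat_strong_rec
    (f := fun b n => ((ofCode n).hat b, (ofCode n).quants b))
    (g := fun b l => some (scanStep b l)) (Primrec.option_some.comp primrec_scanStep)
    (fun b n => congrArg some (scanStep_range b n))
  have := this.comp hb (primrec_code hφ)
  simpa only [ofCode_code] using this

@[fun_prop] theorem primrec_hat {b : α → ℕ} (hb : Primrec b) (hφ : Primrec φ) :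
    Primrec fun x => (φ x).hat (b x) := Primrec.fst.comp (primrec_scan hb hφ)

@[fun_prop] theorem primrec_quants {b : α → ℕ} (hb : Primrec b) (hφ : Primrec φ) :
    Primrec fun x => (φ x).quants (b x) := Primrec.snd.comp (primrec_scan hb hφ)

end Formula

/-! ### Primitive recursiveness of the separation. -/

namespace SepCtx

open Formula

def equivProd : SepCtx ≃ ℕ × ℕ × ℕ × Vocab × Vocab × List ℕ where
  toFun c := (c.base, c.K, c.Q, c.C, c.D, c.qs)
  invFun p := ⟨p.1, p.2.1, p.2.2.1, p.2.2.2.1, p.2.2.2.2.1, p.2.2.2.2.2⟩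
  left_inv _ := rfl
  right_inv _ := rfl

instance : Primcodable SepCtx := Primcodable.ofEquiv _ equivProd

variable {α : Type*} [Primcodable α]

@[fun_prop] theorem primrec_mk {b k q : α → ℕ} {C D : α → Vocab} {l : α → List ℕ} (hb : Primrec b)
    (hk : Primrec k) (hq : Primrec q) (hC : Primrec C) (hD : Primrec D) (hl : Primrec l) :
    Primrec fun x => SepCtx.mk (b x) (k x) (q x) (C x) (D x) (l x) :=
  (Primrec.of_equiv_iff equivProd).1
    (hb.pair (hk.pair (hq.pair (hC.pair (hD.pair hl)))))

variable {c : α → SepCtx} {i j : α → ℕ}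

theorem primrec_equivProd (hc : Primrec c) : Primrec fun x => equivProd (c x) :=
  (Primrec.of_equiv_iff equivProd).2 hc

@[fun_prop] theorem primrec_base (hc : Primrec c) : Primrec fun x => (c x).base :=
  Primrec.fst.comp (primrec_equivProd hc)
@[fun_prop] theorem primrec_K (hc : Primrec c) : Primrec fun x => (c x).K :=
  Primrec.fst.comp (Primrec.snd.comp (primrec_equivProd hc))
@[fun_prop] theorem primrec_Q (hc : Primrec c) : Primrec fun x => (c x).Q :=
  Primrec.fst.comp (Primrec.snd.comp (Primrec.snd.comp (primrec_equivProd hc)))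
@[fun_prop] theorem primrec_C (hc : Primrec c) : Primrec fun x => (c x).C :=
  Primrec.fst.comp (Primrec.snd.comp (Primrec.snd.comp (Primrec.snd.comp (primrec_equivProd hc))))
@[fun_prop] theorem primrec_D (hc : Primrec c) : Primrec fun x => (c x).D :=
  Primrec.fst.comp (Primrec.snd.comp (Primrec.snd.comp (Primrec.snd.comp (Primrec.snd.comp
    (primrec_equivProd hc)))))
@[fun_prop] theorem primrec_qs (hc : Primrec c) : Primrec fun x => (c x).qs :=
  Primrec.snd.comp (Primrec.snd.comp (Primrec.snd.comp (Primrec.snd.comp (Primrec.snd.comp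
    (primrec_equivProd hc)))))

@[fun_prop] theorem primrec_J (hc : Primrec c) : Primrec fun x => (c x).J := by
  unfold J; fun_prop
@[fun_prop] theorem primrec_hatB (hc : Primrec c) (hi : Primrec i) :
    Primrec fun x => (c x).hatB (i x) := by unfold hatB; fun_prop
@[fun_prop] theorem primrec_wit (hc : Primrec c) (hi : Primrec i) :
    Primrec fun x => (c x).wit (i x) := by unfold wit; fun_prop
@[fun_prop] theorem primrec_link (hc : Primrec c) (hi : Primrec i) (hj : Primrec j) :
    Primrec fun x => (c x).link (i x) (j x) := by unfold link; fun_prop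
@[fun_prop] theorem primrec_truth (hc : Primrec c) (hi : Primrec i) :
    Primrec fun x => (c x).truth (i x) := by unfold truth; fun_prop
@[fun_prop] theorem primrec_color (hc : Primrec c) (hi : Primrec i) :
    Primrec fun x => (c x).color (i x) := by unfold color; fun_prop
@[fun_prop] theorem primrec_loop (hc : Primrec c) (hi : Primrec i) :
    Primrec fun x => (c x).loop (i x) := by unfold loop; fun_prop
@[fun_prop] theorem primrec_fwd (hc : Primrec c) (hi : Primrec i) (hj : Primrec j) :
    Primrec fun x => (c x).fwd (i x) (j x) := by unfold fwd; fun_prop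
@[fun_prop] theorem primrec_bwd (hc : Primrec c) (hi : Primrec i) (hj : Primrec j) :
    Primrec fun x => (c x).bwd (i x) (j x) := by unfold bwd; fun_prop
@[fun_prop] theorem primrec_dom (hc : Primrec c) (hi : Primrec i) :
    Primrec fun x => (c x).dom (i x) := by unfold dom; fun_prop
@[fun_prop] theorem primrec_succ (hc : Primrec c) (hi : Primrec i) (hj : Primrec j) :
    Primrec fun x => (c x).succ (i x) (j x) := by unfold succ; fun_prop

@[fun_prop] theorem primrec_binD (hc : Primrec c) : Primrec fun x => (c x).binD := by
  unfold binD; fun_prop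
@[fun_prop] theorem primrec_unType (hc : Primrec c) : Primrec fun x => (c x).unType := by
  unfold unType; fun_prop
@[fun_prop] theorem primrec_allUn (hc : Primrec c) : Primrec fun x => (c x).allUn := by
  unfold allUn; fun_prop
@[fun_prop] theorem primrec_C' (hc : Primrec c) : Primrec fun x => (c x).C' := by
  unfold C'; fun_prop
@[fun_prop] theorem primrec_D' (hc : Primrec c) : Primrec fun x => (c x).D' := by
  unfold D'; fun_prop
@[fun_prop] theorem primrec_linkAx (hc : Primrec c) (hi : Primrec i) :
    Primrec fun x => (c x).linkAx (i x) := by unfold linkAx; fun_prop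
@[fun_prop] theorem primrec_alphaAx (hc : Primrec c) : Primrec fun x => (c x).alphaAx := by
  unfold alphaAx; fun_prop
@[fun_prop] theorem primrec_msg (hc : Primrec c) (hi : Primrec i) (hj : Primrec j) :
    Primrec fun x => (c x).msg (i x) (j x) := by unfold msg; fun_prop
@[fun_prop] theorem primrec_witAx (hc : Primrec c) (hi : Primrec i) :
    Primrec fun x => (c x).witAx (i x) := by unfold witAx; fun_prop
@[fun_prop] theorem primrec_betaAx (hc : Primrec c) : Primrec fun x => (c x).betaAx := by
  unfold betaAx; fun_prop
@[fun_prop] theorem primrec_alpha' {φ : α → Formula} (hc : Primrec c) (hφ : Primrec φ) :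
    Primrec fun x => (c x).alpha' (φ x) := by unfold alpha'; fun_prop
@[fun_prop] theorem primrec_beta' {φ : α → Formula} (hc : Primrec c) (hφ : Primrec φ) :
    Primrec fun x => (c x).beta' (φ x) := by unfold beta'; fun_prop
@[fun_prop] theorem primrec_colorBound {l : α → List ℕ} (hi : Primrec i) (hl : Primrec l) :
    Primrec fun x => colorBound (i x) (l x) := by unfold colorBound witBound; fun_prop

/-- A number that is larger than all members of the list. -/
def above (l : List ℕ) : ℕ := l.foldr (fun a n => a + n + 1) 0

theorem lt_above {l : List ℕ} {a : ℕ} (h : a ∈ l) : a < above l := by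
  induction l with
  | nil => simp at h
  | cons b l ih =>
    rw [above, List.foldr_cons, ← above]
    rcases List.mem_cons.1 h with rfl | h
    · omega
    · have := ih h; omega

@[fun_prop] theorem primrec_above {l : α → List ℕ} (hl : Primrec l) :
    Primrec fun x => above (l x) := by unfold above; fun_prop

/-- The data for separating sentences over `C` and `D`. -/
def ofSentence (K : ℕ) (C D : Vocab) (β : Formula) : SepCtx :=
  -- The binary symbols of `D` need not lie below the bound, as they occur only renamed.
  let b := above (C.un ++ (C.bin ++ D.un))
  ⟨b, K, colorBound K (β.quants b), C, D, β.quants b⟩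

@[fun_prop] theorem primrec_ofSentence {C D : α → Vocab} {φ : α → Formula} (hi : Primrec i)
    (hC : Primrec C) (hD : Primrec D) (hφ : Primrec φ) :
    Primrec fun x => ofSentence (i x) (C x) (D x) (φ x) := by unfold ofSentence; fun_prop

/-- The separation of a pair of sentences. -/
def separate (x : ℕ × (Vocab × Vocab) × (Formula × Formula)) :
    (Vocab × Vocab) × (Formula × Formula) :=
  let c := ofSentence x.1 x.2.1.1 x.2.1.2 x.2.2.2
  ((c.C', c.D'), (c.alpha' x.2.2.1, c.beta' x.2.2.2))

theorem primrec_separate : Primrec separate := by unfold separate; fun_prop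

/-- The separated sentences have the same models, up to the Gaifman graph over the first
vocabulary. -/
theorem exists_model_iff_separated {k : ℕ} {C D : Vocab} {α β : Formula} (hα : α ∈ MSO C)
    (hβ : β ∈ C2 D) {V : Type u} [Finite V] [Nonempty V] {G : SimpleGraph V}
    (hG : G.IsKBounded (k + 1)) :
    let c := ofSentence k C D β
    (∃ M : Str (C ∪ D) V, M.Models α ∧ M.Models β ∧
        (M.reduct (Vocab.subset_union_left C D)).gaifman = G) ↔
      ∃ N : Str (c.C' ∪ c.D') V, N.Models (c.alpha' α) ∧ N.Models (c.beta' β) ∧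
        (N.reduct (Vocab.subset_union_left c.C' c.D')).gaifman = G := by
  intro c
  constructor
  · rintro ⟨M, hMα, hMβ, rfl⟩
    exact exists_separated_model (c := c) hα hβ rfl rfl
      (fun P hP => lt_above (List.mem_append_left _ hP))
      (fun B hB => lt_above (List.mem_append_right _ (List.mem_append_left _ hB)))
      (fun P hP => lt_above (List.mem_append_right _ (List.mem_append_right _ hP))) M hMα hMβ hG
  · rintro ⟨N, hNα, hNβ, rfl⟩
    exact exists_model_of_separated (c := c) hα hβ rfl N hNα hNβ

end SepCtx

/-- Taking `k` itself as the bound `K` on the out-degree handles all `(k + 1)`-bounded graphs. This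
is what tree-width `k` requires, and it includes the `k`-bounded graphs of the first statement. -/
theorem mainTheorem4 :
    ∃ F : ℕ × (Vocab × Vocab) × (Formula × Formula) → (Vocab × Vocab) × (Formula × Formula),
      Computable F ∧
      ∀ (k : ℕ) (C D : Vocab) (α β : Formula), α ∈ MSO C → β ∈ C2 D →
        ∃ (C' D' : Vocab) (α' β' : Formula),
          F (k, (C, D), (α, β)) = ((C', D'), (α', β')) ∧
          α' ∈ MSO C' ∧ β' ∈ C2 D' ∧ C'.ShareOnlyUnary D' ∧
          (∀ (V : Type u) [Finite V] [Nonempty V] (G : SimpleGraph V), G.IsKBounded k →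
            ((∃ M : Str (C ∪ D) V, M.Models α ∧ M.Models β ∧
                (M.reduct (Vocab.subset_union_left C D)).gaifman = G) ↔
              (∃ N : Str (C' ∪ D') V, N.Models α' ∧ N.Models β' ∧
                (N.reduct (Vocab.subset_union_left C' D')).gaifman = G))) ∧
          ((∃ (V : Type u) (_ : Finite V) (_ : Nonempty V) (M : Str (C ∪ D) V),
              M.Models α ∧ M.Models β ∧
                (M.reduct (Vocab.subset_union_left C D)).gaifman.TreewidthLE k) ↔
            (∃ (V : Type u) (_ : Finite V) (_ : Nonempty V) (N : Str (C' ∪ D') V),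
              N.Models α' ∧ N.Models β' ∧
                (N.reduct (Vocab.subset_union_left C' D')).gaifman.TreewidthLE k)) := by
  refine ⟨SepCtx.separate, SepCtx.primrec_separate.to_comp, fun k C D α β hα hβ => ?_⟩
  let c := SepCtx.ofSentence k C D β
  refine ⟨c.C', c.D', c.alpha' α, c.beta' β, rfl, SepCtx.alpha'_mem hα, SepCtx.beta'_mem hβ rfl,
    SepCtx.shareOnlyUnary fun B hB => SepCtx.lt_above (List.mem_append_right _ (List.mem_append_left _ hB)),
    fun V _ _ G hG => SepCtx.exists_model_iff_separated hα hβ (hG.mono (Nat.le_succ k)), ?_⟩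
  constructor
  · rintro ⟨V, _, _, M, hα', hβ', htw⟩
    obtain ⟨N, h1, h2, h3⟩ :=
      (SepCtx.exists_model_iff_separated hα hβ htw.isKBounded).1 ⟨M, hα', hβ', rfl⟩
    exact ⟨V, inferInstance, inferInstance, N, h1, h2, h3 ▸ htw⟩
  · rintro ⟨V, _, _, N, hα', hβ', htw⟩
    obtain ⟨M, h1, h2, h3⟩ :=
      (SepCtx.exists_model_iff_separated hα hβ htw.isKBounded).2 ⟨N, hα', hβ', rfl⟩
    exact ⟨V, inferInstance, inferInstance, M, h1, h2, h3 ▸ htw⟩
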